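/- Let $\lambda:\mathbb{Z}_+\to[0,\infty)$ with $\lambda(0)>0$, and let $0<\mu_1<\mu_2$. Let $X$ be the minimal continuous-time Markov process on $\mathbb{Z}_+^2\cup\{\kappa\}$ (where $\kappa$ is an additional state entered at the time of explosion, if $X$ explodes) with transition rates, for $x\neq y$ in $\mathbb{Z}_+^2$, \[ q(x,y)=\begin{cases}\lambda(x_2), & y=x+e_1,\\ \mu_1, & y=x-e_1+e_2\ge 0,\\ \mu_2, & y=x-e_2\ge 0,\\ 0, & \text{otherwise,}\end{cases} \] where $e_1,e_2$ are the unit vectors. The system $S(\lambda,\mu_1,\mu_2)$ is called stable if $X$ is ergodic, that is, irreducible and positive recurrent ($\operatorname{E}_x T_x<\infty$ for all $x\in\mathbb{Z}_+^2$, where $T_x=\inf\{t>0: X(t-)\neq X(t),\ X(t)=x\}$), and unstable otherwise. Let $Z$ be a random variable on $\mathbb{Z}_+$ with the geometric distribution $\operatorname{P}(Z=j)=(1-\mu_1/\mu_2)(\mu_1/\mu_2)^j$, $j\ge 0$. Then: (i) if $\operatorname{E}\lambda(Z)<\mu_1$, then $S(\lambda,\mu_1,\mu_2)$ is stable; (ii)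 if $\operatorname{E}\lambda(Z)>\mu_1$ (including the case $\operatorname{E}\lambda(Z)=\infty$), then $S(\lambda,\mu_1,\mu_2)$ is unstable. -/

import Mathlib

open MeasureTheory ProbabilityTheory
open scoped NNReal ENNReal Topology

/-- Transition rates on a state space `S`: `q x y` is the rate from `x` to `y` for `x ≠ y`, and the
total rate out of every state is finite. The diagonal is stored as `0`, so that the
total rate out of `x` is `∑ y, q x y`. -/
structure TransitionRates (S : Type*) where
  q : S → S → ℝ≥0
  q_self : ∀ x, q x x = 0
  summable_q : ∀ x, Summable (q x)

namespace TransitionRates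

section MinimalConstruction

variable {S : Type*} (R : TransitionRates S)

/-- The total rate `q(x)` out of the state `x`. -/
noncomputable def outRate (x : S) : ℝ≥0 := ∑' y, R.q x y

open Classical in
/-- The law of the next state of the jump chain: from `x` the chain moves to `y` with probability
`q(x, y) / q(x)`; an absorbing state (one with `q(x) = 0`) is never left. -/
noncomputable def jumpPMF (x : S) : PMF S :=
  if h : R.outRate x = 0 then PMF.pure x
  else ⟨fun y => ((R.q x y / R.outRate x : ℝ≥0) : ℝ≥0∞), by
    have h1 : HasSum (fun y => R.q x y / R.outRate x) (R.outRate x / R.outRate x) :=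
      (R.summable_q x).hasSum.div_const _
    rw [div_self h] at h1
    rw [← ENNReal.coe_one]
    exact ENNReal.hasSum_coe.mpr h1⟩

/-- The sample space of the minimal construction: a path of the jump chain together with
a sequence of clocks. -/
abbrev PathSpace (S : Type*) : Type _ := (ℕ → S) × (ℕ → ℝ)

/-- The time `J_n` of the `n`-th jump (`J_0 = 0`). The sojourn in the `i`-th visited state `y` lasts
for `E_i / q(y)`, with `E_i` the `i`-th clock; it lasts forever if `q(y) = 0`. -/
noncomputable def jumpTime (ω : PathSpace S) (n : ℕ) : ℝ≥0∞ :=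
  ∑ i ∈ Finset.range n, ENNReal.ofReal (ω.2 i) / (R.outRate (ω.1 i) : ℝ≥0∞)

open Classical in
/-- The minimal process: `X(t)` is the `n`-th state of the jump chain for `J_n ≤ t < J_{n+1}`.
The value `none` is the additional state `κ`, in which `X` stays from the time of explosion on. -/
noncomputable def process (t : ℝ≥0) (ω : PathSpace S) : Option S :=
  if h : ∃ n : ℕ, R.jumpTime ω n ≤ t ∧ (t : ℝ≥0∞) < R.jumpTime ω (n + 1) then
    some (ω.1 (Nat.find h))
  else none

/-- `T_x = inf {t > 0 : X(t-) ≠ X(t), X(t) = x}`, with `inf ∅ = ∞`. Since the state space is discrete,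
`X(t-) ≠ X(t)` says that `X` is not constantly equal to `X(t)` just before `t`. -/
noncomputable def hittingTime (x : S) (ω : PathSpace S) : ℝ≥0∞ :=
  ⨅ (t : ℝ≥0) (_ : 0 < t ∧ (¬ ∀ᶠ s in 𝓝[<] t, R.process s ω = R.process t ω) ∧
    R.process t ω = some x), (t : ℝ≥0∞)

variable [Countable S] [MeasurableSpace S] [DiscreteMeasurableSpace S]

/-- The transition kernel of the jump chain. -/
noncomputable def jumpKernel : Kernel S S where
  toFun x := (R.jumpPMF x).toMeasure
  measurable' := measurable_of_countable _

instance : IsMarkovKernel R.jumpKernel :=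
  ⟨fun x => PMF.toMeasure.isProbabilityMeasure (R.jumpPMF x)⟩

/-- The law of the jump chain started at `x`: a homogeneous Markov chain with transition
kernel `jumpKernel`. -/
noncomputable def chainLaw (x : S) : Measure (ℕ → S) :=
  Kernel.trajMeasure (X := fun _ => S) (Measure.dirac x)
    (fun n => R.jumpKernel.comap
      (fun h : (i : Finset.Iic n) → S => h ⟨n, Finset.mem_Iic.mpr le_rfl⟩)
      (measurable_pi_apply _))

/-- The law `P_x` of the minimal construction started at `x`: the clocks are independent
exponential variables with mean one, independent of the jump chain. -/
noncomputable def pathLaw (x : S) : Measure (PathSpace S) :=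
  (R.chainLaw x).prod (Measure.infinitePi fun _ : ℕ => expMeasure 1)

/-- Irreducibility: for all `x, y` there is a time `t ≥ 0` with `P_x(X(t) = y) > 0`. -/
def IsIrreducible : Prop :=
  ∀ x y : S, ∃ t : ℝ≥0, 0 < R.pathLaw x {ω | R.process t ω = some y}

/-- Positive recurrence: the mean return time `E_x T_x` is finite for every state `x`
(an absorbing state is positive recurrent by convention). -/
def IsPositiveRecurrent : Prop :=
  ∀ x : S, R.outRate x = 0 ∨ ∫⁻ ω, R.hittingTime x ω ∂(R.pathLaw x) < ∞

/-- Ergodicity: irreducibility and positive recurrence. -/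
def IsErgodic : Prop := R.IsIrreducible ∧ R.IsPositiveRecurrent

end MinimalConstruction

end TransitionRates

/-- The transition rates of the tandem network: the state `(x.1, x.2)` holds the numbers of jobs in
nodes 1 and 2. Arrivals to node 1 have rate `lam x.2`, a nonempty node 1 sends
jobs to node 2 at rate `μ₁`, and jobs leave a nonempty node 2 at rate `μ₂`. -/
def tandemRate (lam : ℕ → ℝ≥0) (μ₁ μ₂ : ℝ≥0) (x y : ℕ × ℕ) : ℝ≥0 :=
  if y.1 = x.1 + 1 ∧ y.2 = x.2 then lam x.2
  else if y.1 + 1 = x.1 ∧ y.2 = x.2 + 1 then μ₁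
  else if y.1 = x.1 ∧ y.2 + 1 = x.2 then μ₂
  else 0

/-- The system `S(lam, μ₁, μ₂)`. -/
def tandemSystem (lam : ℕ → ℝ≥0) (μ₁ μ₂ : ℝ≥0) : TransitionRates (ℕ × ℕ) where
  q := tandemRate lam μ₁ μ₂
  q_self x := by simp [tandemRate]
  summable_q x := by
    refine summable_of_ne_finset_zero
      (s := Finset.range (x.1 + 2) ×ˢ Finset.range (x.2 + 2)) fun y hy => ?_
    simp only [Finset.mem_product, Finset.mem_range] at hy
    unfold tandemRate
    rw [if_neg (by omega), if_neg (by omega), if_neg (by omega)]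

/-- A system is stable if the corresponding Markov process is ergodic. -/
def IsStableSystem (lam : ℕ → ℝ≥0) (μ₁ μ₂ : ℝ≥0) : Prop :=
  (tandemSystem lam μ₁ μ₂).IsErgodic

/-- `Z ∼ geom(z)`: the random variable `Z` on `ℕ` satisfies `P(Z = j) = (1 - z) z ^ j`. -/
def IsGeom {Ω : Type*} [MeasurableSpace Ω] (P : Measure Ω) (Z : Ω → ℕ) (z : ℝ) : Prop :=
  Measurable Z ∧ ∀ j : ℕ, P {ω | Z ω = j} = ENNReal.ofReal ((1 - z) * z ^ j)

/-!
The transition kernel of the jump chain is written `P`, the total rate out of `x` is `q x`, and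
`T f x = ∫_{z ≠ y} f z P(x, dz)` is the kernel killed on entering a state `y` (`stayOp {y}ᶜ`).

**From the process to the kernel.** `T_y` can only be a jump time at which the chain is in `y`,
and almost surely the first return provides such a time (`stayTime_le_hittingTime`,
`hittingTime_le_stayTime`). The sojourn times have conditional means `1 / q`, so the mean return
time is the sum of the iterates `Tⁿ(1/q)(y)` (`lintegral_stayTime`). Hence it is finite when `q` is
bounded below and `∑ Tⁿ 1 (y) < ∞`; conversely, when it is finite, `∑ Tⁿ(1/q)(y) < ∞` and
`Tⁿ 1 (y) → 0`. All else is an argument about `T` acting on nonnegative functions.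

**The test function.** As long as node 1 is busy, node 2 is an M/M/1 queue with arrival rate `μ₁`
and service rate `μ₂`, whose stationary law is that of `Z`. Let `l : ℕ → ℝ` have mean `c = E l(Z)`,
and let `h` solve the Poisson equation of that queue with right-hand side `c - l`
(`exists_poisson`; `d j = h (j + 1) - h j`). The function `x₁ + h x₂` has drift
`λ(x₂) - l(x₂) + c - μ₁` where `x₁ > 0`, and `λ(x₂) - μ₂ d (x₂ - 1)` where `x₁ = 0 < x₂`.

* If `E λ(Z) < μ₁`, take `l(j) = (1 + δ) λ(j) + δ j` with `δ` so small that `c < μ₁`. The drift is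
  then at most `-ε q` off a finite set, so the jump chain itself satisfies Foster's criterion
  (`tsum_stayOp_iterate_one_ne_top`). Comparing the drift with `q`, and not with a constant, makes
  the number of jumps before the return integrable, which also rules out explosion.
* If `E λ(Z) > μ₁`, take for `l` a finite cut-off of `λ` such that still `c > μ₁`. The drift is then
  nonnegative off a finite set. As `λ` may be unbounded, `x₁ + h x₂` is replaced by
  `min x₁ M + h x₂`, which is bounded above, at the cost of a negative drift, bounded
  uniformly in `M`, on `{x₁ ≥ M}`. If the mean return time to `(0, 0)` were finite, the chain
  started at `(m, 0)` would reach `(0, 0)`, and the time it spends in `{x₁ ≥ M}` on the way would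
  vanish in mean as `M → ∞`. The test function at `(0, 0)` would then be at least its value at
  `(m, 0)`, up to a bounded error, which fails for large `m` (`tandem_not_isStable`).

In both cases the finite exceptional set is dealt with by `exists_bounded_drift`.
-/

/-! ### The jump chain and its killed transition kernel -/

namespace TransitionRates

variable {S : Type*} [Countable S] [MeasurableSpace S] [DiscreteMeasurableSpace S]
  (R : TransitionRates S)

/-- The transition operator of the jump chain killed on leaving `A`: `f` is integrated against the
law of the next state, restricted to `A`. For `A = univ` this is the transition operator itself. -/
noncomputable def stayOp (A : Set S) (f : S → ℝ≥0∞) (x : S) : ℝ≥0∞ :=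
  ∫⁻ z in A, f z ∂(R.jumpKernel x)

instance (x : S) : IsProbabilityMeasure (R.chainLaw x) := by
  unfold chainLaw; infer_instance

theorem chainLaw_eq_traj (x : S) : R.chainLaw x =
    Kernel.traj (X := fun _ => S) (fun n => R.jumpKernel.comap
      (fun h : (i : Finset.Iic n) → S => h ⟨n, Finset.mem_Iic.mpr le_rfl⟩)
      (measurable_pi_apply _)) 0 (fun _ => x) := by
  have h : (Measure.dirac x).map (MeasurableEquiv.piUnique fun _ : Finset.Iic 0 => S).symm =
      Measure.dirac (fun _ => x) :=
    Measure.map_dirac _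
  refine (congrArg (fun ν => Measure.bind ν _) h).trans ?_
  exact Measure.dirac_bind (Kernel.measurable _) _

theorem chainLaw_ae_zero (x : S) : ∀ᵐ X ∂(R.chainLaw x), X 0 = x := by
  have h : (R.chainLaw x).map (Preorder.frestrictLe (π := fun _ : ℕ => S) 0)
      = Measure.dirac (fun _ => x) := by
    rw [chainLaw_eq_traj, Kernel.traj_map_frestrictLe_apply, Kernel.partialTraj_self,
      Kernel.id_apply]
  have h2 : ∀ᵐ Y ∂((R.chainLaw x).map (Preorder.frestrictLe (π := fun _ : ℕ => S) 0)),
      Y ⟨0, by simp⟩ = x := by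
    rw [h, ae_dirac_eq]; rfl
  exact ae_of_ae_map (by fun_prop) h2

/-- The Markov property of the jump chain at time `n`. -/
theorem lintegral_chainLaw_succ (x : S) (n : ℕ)
    (d : ((i : Finset.Iic n) → S) → ℝ≥0∞) (f : S → ℝ≥0∞) :
    ∫⁻ X, d (Preorder.frestrictLe (π := fun _ : ℕ => S) n X) * f (X (n + 1)) ∂(R.chainLaw x) =
    ∫⁻ X, d (Preorder.frestrictLe (π := fun _ : ℕ => S) n X) * (∫⁻ z, f z ∂(R.jumpKernel (X n)))
      ∂(R.chainLaw x) := by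
  have hd : Measurable d := measurable_of_countable _
  have hf : Measurable f := measurable_of_countable _
  have key := Kernel.map_frestrictLe_trajMeasure_compProd_eq_map_trajMeasure
    (X := fun _ : ℕ => S) (μ₀ := Measure.dirac x)
    (κ := fun n => R.jumpKernel.comap
      (fun h : (i : Finset.Iic n) → S => h ⟨n, Finset.mem_Iic.mpr le_rfl⟩)
      (measurable_pi_apply _)) (a := n)
  have h1 : ∫⁻ X, d (Preorder.frestrictLe (π := fun _ : ℕ => S) n X) * f (X (n + 1))
      ∂(R.chainLaw x) = ∫⁻ p, d p.1 * f p.2 ∂((R.chainLaw x).map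
        (fun X => (Preorder.frestrictLe (π := fun _ : ℕ => S) n X, X (n + 1)))) := by
    rw [lintegral_map (by fun_prop) (by fun_prop)]
  rw [h1, chainLaw, ← key, Measure.lintegral_compProd (by fun_prop),
    lintegral_map (measurable_of_countable _) (by fun_prop)]
  refine lintegral_congr fun X => ?_
  exact lintegral_const_mul (d (Preorder.frestrictLe (π := fun _ : ℕ => S) n X)) hf

/-- The event that the jump chain is in `A` at the times `1, …, n`. -/
def stayEvent (A : Set S) (n : ℕ) : Set (ℕ → S) := {X | ∀ i < n, X (i + 1) ∈ A}

set_option linter.unusedSectionVars false in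
theorem measurableSet_stayEvent (A : Set S) (n : ℕ) : MeasurableSet (stayEvent A n) := by
  have : stayEvent A n = ⋂ i < n, (fun X : ℕ → S => X (i + 1)) ⁻¹' A := by
    ext X; simp [stayEvent]
  rw [this]
  exact MeasurableSet.iInter fun i => MeasurableSet.iInter fun _ =>
    (measurable_pi_apply _) (MeasurableSet.of_discrete)

/-- The mean of `f (X n)` on the event that the chain is in `A` at the times `1, …, n` is the `n`-th
iterate of the killed operator. The starting point need not lie in `A`, which is what makes
`A = {y}ᶜ` describe the return to `y`. -/
theorem lintegral_stayEvent (A : Set S) (x : S) (n : ℕ) (f : S → ℝ≥0∞) :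
    ∫⁻ X, (stayEvent A n).indicator (fun X => f (X n)) X ∂(R.chainLaw x) =
      (R.stayOp A)^[n] f x := by
  induction n generalizing f with
  | zero =>
    have h : ∀ᵐ X ∂(R.chainLaw x), (stayEvent A 0).indicator (fun X => f (X 0)) X = f x := by
      filter_upwards [R.chainLaw_ae_zero x] with X hX
      simp [stayEvent, hX]
    rw [lintegral_congr_ae h]
    simp
  | succ n ih =>
    rw [Function.iterate_succ_apply, ← ih]
    -- The event up to time `n`, as a function of the first coordinates.
    let E : Set ((i : Finset.Iic n) → S) :=
      {Y | ∀ (i : ℕ) (hi : i < n), Y ⟨i + 1, Finset.mem_Iic.mpr hi⟩ ∈ A}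
    have hE : ∀ X : ℕ → S, Preorder.frestrictLe (π := fun _ : ℕ => S) n X ∈ E ↔
      X ∈ stayEvent A n := fun X => Iff.rfl
    refine (Eq.trans ?_ (R.lintegral_chainLaw_succ x n (E.indicator 1) (A.indicator f))).trans ?_
    · refine lintegral_congr fun X => ?_
      have hs : X ∈ stayEvent A (n + 1) ↔ X ∈ stayEvent A n ∧ X (n + 1) ∈ A := by
        simp only [stayEvent, Set.mem_ofPred_eq, Nat.lt_succ_iff_lt_or_eq, or_imp, forall_and,
          forall_eq]
      by_cases h1 : X ∈ stayEvent A n <;> by_cases h2 : X (n + 1) ∈ A <;>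
        simp [Set.indicator, hs, hE, h1, h2]
    · refine lintegral_congr fun X => ?_
      rw [lintegral_indicator MeasurableSet.of_discrete]
      by_cases h1 : X ∈ stayEvent A n <;> simp [Set.indicator, hE, h1, stayOp]

end TransitionRates

/-! ### Drift criteria for the killed kernel -/

namespace TransitionRates

variable {S : Type*} [Countable S] [MeasurableSpace S] [DiscreteMeasurableSpace S]
  (R : TransitionRates S)

theorem stayOp_mono {A : Set S} {f g : S → ℝ≥0∞} (h : f ≤ g) : R.stayOp A f ≤ R.stayOp A g :=
  fun _ => lintegral_mono h

theorem stayOp_add (A : Set S) (f g : S → ℝ≥0∞) :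
    R.stayOp A (f + g) = R.stayOp A f + R.stayOp A g :=
  funext fun _ => lintegral_add_left (measurable_of_countable _) _

theorem stayOp_smul (A : Set S) (c : ℝ≥0∞) (f : S → ℝ≥0∞) :
    R.stayOp A (c • f) = c • R.stayOp A f :=
  funext fun _ => lintegral_const_mul _ (measurable_of_countable _)

theorem stayOp_sum (A : Set S) (s : Finset ℕ) (f : ℕ → S → ℝ≥0∞) :
    R.stayOp A (∑ k ∈ s, f k) = ∑ k ∈ s, R.stayOp A (f k) := by
  funext x
  simp only [stayOp, Finset.sum_apply]
  exact lintegral_finsetSum _ fun _ _ => measurable_of_countable _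

theorem stayOp_le_lintegral (A : Set S) (f : S → ℝ≥0∞) (x : S) :
    R.stayOp A f x ≤ ∫⁻ z, f z ∂(R.jumpKernel x) :=
  setLIntegral_le_lintegral _ _

theorem stayOp_one_le (A : Set S) : R.stayOp A 1 ≤ 1 := fun x => by
  simpa [stayOp] using prob_le_one

theorem stayOp_iterate_mono {A : Set S} (n : ℕ) {f g : S → ℝ≥0∞} (h : f ≤ g) :
    (R.stayOp A)^[n] f ≤ (R.stayOp A)^[n] g :=
  (show Monotone (R.stayOp A) from fun _ _ h => R.stayOp_mono h).iterate n h

theorem stayOp_iterate_smul (A : Set S) (n : ℕ) (c : ℝ≥0∞) (f : S → ℝ≥0∞) :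
    (R.stayOp A)^[n] (c • f) = c • (R.stayOp A)^[n] f := by
  induction n generalizing f with
  | zero => rfl
  | succ n ih => rw [Function.iterate_succ_apply, stayOp_smul, ih, ← Function.iterate_succ_apply]

theorem stayOp_iterate_one_antitone (A : Set S) : Antitone fun n => (R.stayOp A)^[n] 1 :=
  antitone_nat_of_succ_le fun n => R.stayOp_iterate_mono n (R.stayOp_one_le A)

theorem stayOp_iterate_one_le (A : Set S) (n : ℕ) : (R.stayOp A)^[n] 1 ≤ 1 :=
  R.stayOp_iterate_one_antitone A (Nat.zero_le n)

theorem mul_jumpKernel_le_stayOp {A : Set S} {z : S} (hz : z ∈ A) (f : S → ℝ≥0∞) (x : S) :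
    f z * R.jumpKernel x {z} ≤ R.stayOp A f x := by
  calc f z * R.jumpKernel x {z} = ∫⁻ u in {z}, f u ∂(R.jumpKernel x) := by simp [mul_comm]
    _ ≤ R.stayOp A f x := lintegral_mono_set (by simpa using hz)

/-- A mean of values at most one is less than one if one of them is and has positive weight. -/
theorem lintegral_jumpKernel_lt_one {g : S → ℝ≥0∞} (hg : g ≤ 1) {x z : S} (hz : g z < 1)
    (hxz : R.jumpKernel x {z} ≠ 0) : ∫⁻ u, g u ∂(R.jumpKernel x) < 1 := by
  have h : ∫⁻ u, g u ∂(R.jumpKernel x) + (1 - g z) * R.jumpKernel x {z} ≤ 1 := by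
    calc ∫⁻ u, g u ∂(R.jumpKernel x) + (1 - g z) * R.jumpKernel x {z}
        = ∫⁻ u, g u + Set.indicator {z} (fun _ => 1 - g z) u ∂(R.jumpKernel x) := by
          rw [lintegral_add_left (measurable_of_countable _),
            lintegral_indicator_const MeasurableSet.of_discrete]
      _ ≤ ∫⁻ _, 1 ∂(R.jumpKernel x) := by
          refine lintegral_mono fun u => ?_
          by_cases hu : u = z
          · subst hu
            simpa using (add_tsub_cancel_of_le hz.le).le
          · simpa [hu] using hg u
      _ = 1 := by simp
  have h2 : (1 - g z) * R.jumpKernel x {z} ≠ 0 := mul_ne_zero (tsub_pos_of_lt hz).ne' hxz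
  refine lt_of_lt_of_le (ENNReal.lt_add_right ?_ h2) h
  exact (lt_of_le_of_lt (le_self_add.trans h) ENNReal.one_lt_top).ne

theorem stayOp_one_lt_one {A : Set S} {x z : S} (hz : z ∉ A) (hxz : R.jumpKernel x {z} ≠ 0) :
    R.stayOp A 1 x < 1 := by
  rw [stayOp, ← lintegral_indicator MeasurableSet.of_discrete]
  refine R.lintegral_jumpKernel_lt_one (Set.indicator_le_self' fun _ _ => zero_le) ?_ hxz
  simp [hz]

theorem stayOp_lt_one {A : Set S} {f : S → ℝ≥0∞} (hf : f ≤ 1) {x z : S} (hz : f z < 1)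
    (hxz : R.jumpKernel x {z} ≠ 0) : R.stayOp A f x < 1 :=
  (R.stayOp_le_lintegral A f x).trans_lt (R.lintegral_jumpKernel_lt_one hf hz hxz)

/-- If the jump chain can reach `y` from `x` in at least one step, then it avoids `y` for some
number of steps with probability less than one. -/
theorem exists_stayOp_iterate_one_lt_one {x y : S}
    (h : Relation.TransGen (fun u v => R.jumpKernel u {v} ≠ 0) x y) :
    ∃ n, (R.stayOp {y}ᶜ)^[n] 1 x < 1 := by
  induction h using Relation.TransGen.head_induction_on with
  | single h => exact ⟨1, R.stayOp_one_lt_one (by simp) h⟩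
  | head h _ ih =>
    obtain ⟨n, hn⟩ := ih
    refine ⟨n + 1, ?_⟩
    rw [Function.iterate_succ_apply']
    exact R.stayOp_lt_one (R.stayOp_iterate_one_le _ n) hn h

theorem exists_stayOp_univ_iterate_pos {x y : S}
    (h : Relation.ReflTransGen (fun u v => R.jumpKernel u {v} ≠ 0) x y) :
    ∃ n, (R.stayOp Set.univ)^[n] (Set.indicator {y} 1) x ≠ 0 := by
  induction h using Relation.ReflTransGen.head_induction_on with
  | refl => exact ⟨0, by simp⟩
  | head h _ ih =>
    obtain ⟨n, hn⟩ := ih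
    refine ⟨n + 1, fun h0 => mul_ne_zero hn h ?_⟩
    rw [Function.iterate_succ_apply'] at h0
    exact le_antisymm (h0 ▸ R.mul_jumpKernel_le_stayOp (Set.mem_univ _) _ _) zero_le

/-- The mean number of steps before leaving `A`, cut off after `n` steps, decreases by
`1 - Tⁿ 1` in the mean: by the probability of leaving `A` within `n` steps. -/
theorem stayOp_sum_range_iterate_one (A : Set S) (n : ℕ) :
    R.stayOp A (∑ k ∈ Finset.range n, (R.stayOp A)^[k] 1) + 1 =
      (∑ k ∈ Finset.range n, (R.stayOp A)^[k] 1) + (R.stayOp A)^[n] 1 := by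
  rw [stayOp_sum, ← Finset.sum_range_succ, Finset.sum_range_succ']
  simp only [Function.iterate_succ_apply', Function.iterate_zero, id_eq]

/-- On a finite set `F` from which the complement of `A` can be reached, any drift of a test
function can be compensated: the expected number of steps before the chain leaves `A`, cut off
after `n` steps and scaled, is bounded, has nonpositive drift everywhere and negative drift on
`F`. -/
theorem exists_bounded_drift {A F : Set S} (hF : F.Finite)
    (hA : ∀ x ∈ F, ∃ n, (R.stayOp A)^[n] 1 x < 1) (b : ℝ≥0) :
    ∃ (w : S → ℝ≥0∞) (c : ℝ≥0), (∀ x, w x ≤ c) ∧ R.stayOp A w ≤ w ∧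
      ∀ x ∈ F, R.stayOp A w x + b ≤ w x := by
  choose! m hm using hA
  obtain ⟨n, hn⟩ : ∃ n, ∀ x ∈ F, (R.stayOp A)^[n] 1 x < 1 := by
    obtain ⟨n, hn⟩ := (hF.image m).bddAbove
    refine ⟨n, fun x hx => ?_⟩
    exact (R.stayOp_iterate_one_antitone A (hn ⟨x, hx, rfl⟩) x).trans_lt (hm x hx)
  obtain ⟨K, hK⟩ : ∃ K : ℝ≥0, ∀ x ∈ F, (b : ℝ≥0∞) ≤ K * (1 - (R.stayOp A)^[n] 1 x) := by
    obtain ⟨K, hK⟩ := (hF.image fun x =>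
      ((b : ℝ≥0∞) / (1 - (R.stayOp A)^[n] 1 x)).toNNReal).bddAbove
    refine ⟨K, fun x hx => ?_⟩
    have hpos : (1 - (R.stayOp A)^[n] 1 x) ≠ 0 := (tsub_pos_of_lt (hn x hx)).ne'
    have htop : (1 - (R.stayOp A)^[n] 1 x) ≠ ∞ := (tsub_le_self.trans_lt ENNReal.one_lt_top).ne
    rw [← ENNReal.div_le_iff hpos htop]
    rw [← ENNReal.coe_toNNReal (ENNReal.div_ne_top ENNReal.coe_ne_top hpos)]
    exact ENNReal.coe_le_coe.mpr (hK ⟨x, hx, rfl⟩)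
  have hid := R.stayOp_sum_range_iterate_one A n
  set v := ∑ k ∈ Finset.range n, (R.stayOp A)^[k] 1 with hv
  have hvn : ∀ x, v x ≤ n := fun x => by
    rw [hv, Finset.sum_apply]
    calc _ ≤ ∑ k ∈ Finset.range n, (1 : ℝ≥0∞) :=
          Finset.sum_le_sum fun k _ => R.stayOp_iterate_one_le A k x
      _ = n := by simp
  have hidx : ∀ x, R.stayOp A v x + 1 = v x + (R.stayOp A)^[n] 1 x := fun x => congrFun hid x
  have hle : ∀ x, R.stayOp A v x + (1 - (R.stayOp A)^[n] 1 x) = v x := fun x => by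
    have h1 : (R.stayOp A)^[n] 1 x ≤ 1 := R.stayOp_iterate_one_le A n x
    have hfin : (R.stayOp A)^[n] 1 x ≠ ∞ := (h1.trans_lt ENNReal.one_lt_top).ne
    rw [← ENNReal.add_left_inj hfin, ← hidx x, add_assoc, tsub_add_cancel_of_le h1]
  refine ⟨(K : ℝ≥0∞) • v, K * n, fun x => ?_, ?_, fun x hx => ?_⟩
  · simpa using mul_le_mul_right (hvn x) (K : ℝ≥0∞)
  · rw [stayOp_smul]
    intro x
    have : R.stayOp A v x ≤ v x := by rw [← hle x]; exact le_self_add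
    simpa using mul_le_mul_right this (K : ℝ≥0∞)
  · rw [stayOp_smul]
    simp only [Pi.smul_apply, smul_eq_mul]
    rw [← hle x, mul_add]
    simpa [hle x] using add_le_add_right (hK x hx) _

/-- **Foster's criterion**: if `V` has drift at most `-1` off a finite set, then the number of steps
before the chain leaves `A` has finite mean. -/
theorem tsum_stayOp_iterate_one_ne_top {A F : Set S} (hF : F.Finite)
    (hA : ∀ x ∈ F, ∃ n, (R.stayOp A)^[n] 1 x < 1) (V : S → ℝ≥0∞) (hV : ∀ x, V x ≠ ∞)
    (hVF : ∀ x ∈ F, ∫⁻ z, V z ∂(R.jumpKernel x) ≠ ∞)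
    (hdrift : ∀ x ∉ F, ∫⁻ z, V z ∂(R.jumpKernel x) + 1 ≤ V x) (x : S) :
    ∑' n, (R.stayOp A)^[n] 1 x ≠ ∞ := by
  obtain ⟨b, hb⟩ : ∃ b : ℝ≥0, ∀ x ∈ F, ∫⁻ z, V z ∂(R.jumpKernel x) + 1 ≤ b := by
    obtain ⟨b, hb⟩ := (hF.image fun x => (∫⁻ z, V z ∂(R.jumpKernel x) + 1).toNNReal).bddAbove
    refine ⟨b, fun x hx => ?_⟩
    rw [← ENNReal.coe_toNNReal (ENNReal.add_ne_top.mpr ⟨hVF x hx, ENNReal.one_ne_top⟩)]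
    exact ENNReal.coe_le_coe.mpr (hb ⟨x, hx, rfl⟩)
  obtain ⟨w, c, hwc, hw, hwF⟩ := R.exists_bounded_drift hF hA b
  have hW : R.stayOp A (V + w) + 1 ≤ V + w := by
    intro x
    rw [stayOp_add]
    simp only [Pi.add_apply, Pi.one_apply]
    by_cases hx : x ∈ F
    · calc R.stayOp A V x + R.stayOp A w x + 1
          ≤ R.stayOp A w x + (∫⁻ z, V z ∂(R.jumpKernel x) + 1) := by
            rw [add_comm (R.stayOp A V x), add_assoc]
            gcongr
            exact R.stayOp_le_lintegral A V x
        _ ≤ R.stayOp A w x + b := by gcongr; exact hb x hx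
        _ ≤ w x := hwF x hx
        _ ≤ V x + w x := le_add_self
    · calc R.stayOp A V x + R.stayOp A w x + 1
          ≤ (∫⁻ z, V z ∂(R.jumpKernel x) + 1) + w x := by
            rw [add_right_comm]
            gcongr
            exacts [R.stayOp_le_lintegral A V x, hw x]
        _ ≤ V x + w x := by gcongr; exact hdrift x hx
  have hsum : ∀ n, (∑ k ∈ Finset.range n, (R.stayOp A)^[k] 1) +
      (R.stayOp A)^[n] (V + w) ≤ V + w := by
    intro n
    induction n with
    | zero => simp
    | succ n ih =>
      have h1 := add_le_add_left (R.stayOp_mono (A := A) ih) 1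
      rw [stayOp_add, add_right_comm, stayOp_sum_range_iterate_one, ← Finset.sum_range_succ,
        ← Function.iterate_succ_apply' (R.stayOp A)] at h1
      exact h1.trans hW
  have hle : ∑' n, (R.stayOp A)^[n] 1 x ≤ V x + w x := by
    refine ENNReal.tsum_le_of_sum_range_le fun n => ?_
    have := hsum n x
    simp only [Pi.add_apply, Finset.sum_apply] at this
    exact le_self_add.trans this
  refine (hle.trans_lt (ENNReal.add_lt_top.mpr ⟨(hV x).lt_top, ?_⟩)).ne
  exact (hwc x).trans_lt ENNReal.coe_lt_top

/-- If a nonnegative `g` has drift at most `r` until the chain leaves `A`, and equals `s` when it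
does, then it exceeds `s - ∑ r` at the start, the sum of `r` being over the time spent in `A`. -/
theorem le_add_tsum_stayOp_iterate {A : Set S} {g r : S → ℝ≥0∞} {s : ℝ≥0∞} (hs : s ≠ ∞)
    (hg : ∀ x, g x ≠ ∞) (hr : ∀ x, r x ≠ ∞)
    (h : ∀ x, R.stayOp A g x + s ≤ g x + s * R.stayOp A 1 x + r x) {x : S}
    (hx : Filter.Tendsto (fun n => (R.stayOp A)^[n] 1 x) Filter.atTop (𝓝 0)) :
    s ≤ g x + ∑' n, (R.stayOp A)^[n] r x := by
  have key : ∀ n, (R.stayOp A)^[n] g + s • 1 ≤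
      g + s • (R.stayOp A)^[n] 1 + ∑ k ∈ Finset.range n, (R.stayOp A)^[k] r := by
    intro n
    induction n with
    | zero => simp
    | succ n ih =>
      intro x
      have h1 := R.stayOp_mono (A := A) ih x
      simp only [stayOp_add, stayOp_smul, stayOp_sum, ← Function.iterate_succ_apply',
        Pi.add_apply, Pi.smul_apply, Finset.sum_apply, smul_eq_mul] at h1
      simp only [Pi.add_apply, Pi.smul_apply, Finset.sum_apply, smul_eq_mul, Pi.one_apply, mul_one]
      rw [Finset.sum_range_succ' _ n]
      have hfin : s * R.stayOp A 1 x ≠ ∞ :=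
        ENNReal.mul_ne_top hs ((R.stayOp_one_le A x).trans_lt ENNReal.one_lt_top).ne
      rw [← ENNReal.add_le_add_iff_left hfin]
      have h2 := add_le_add h1 (h x)
      have hfin2 : R.stayOp A g x ≠ ∞ := by
        refine ne_top_of_le_ne_top ?_ (le_self_add.trans (h x))
        exact ENNReal.add_ne_top.mpr ⟨ENNReal.add_ne_top.mpr ⟨hg x, hfin⟩, hr x⟩
      rw [← ENNReal.add_le_add_iff_left hfin2]
      calc _ = _ := by ring
        _ ≤ _ := h2
        _ = _ := by simp only [Function.iterate_zero, id_eq]; ring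
  have hlim : Filter.Tendsto (fun n => g x + s * (R.stayOp A)^[n] 1 x + ∑' n, (R.stayOp A)^[n] r x)
      Filter.atTop (𝓝 (g x + s * 0 + ∑' n, (R.stayOp A)^[n] r x)) :=
    (tendsto_const_nhds.add (ENNReal.Tendsto.const_mul hx (Or.inr hs))).add tendsto_const_nhds
  rw [mul_zero, add_zero] at hlim
  refine ge_of_tendsto' hlim fun n => ?_
  have := key n x
  simp only [Pi.add_apply, Pi.smul_apply, Finset.sum_apply, smul_eq_mul, Pi.one_apply,
    mul_one] at this
  refine (le_add_self.trans this).trans ?_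
  gcongr
  exact ENNReal.sum_le_tsum _

end TransitionRates

/-! ### Return times of the minimal process -/

namespace TransitionRates

section Paths

variable {S : Type*} (R : TransitionRates S)

theorem jumpTime_zero (ω : PathSpace S) : R.jumpTime ω 0 = 0 := by simp [jumpTime]

theorem jumpTime_succ (ω : PathSpace S) (n : ℕ) : R.jumpTime ω (n + 1) =
    R.jumpTime ω n + ENNReal.ofReal (ω.2 n) / (R.outRate (ω.1 n) : ℝ≥0∞) :=
  Finset.sum_range_succ _ _

theorem jumpTime_mono (ω : PathSpace S) : Monotone (R.jumpTime ω) :=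
  monotone_nat_of_le_succ fun n => by rw [jumpTime_succ]; exact le_self_add

theorem process_eq_some {ω : PathSpace S} {t : ℝ≥0} {n : ℕ} (h1 : R.jumpTime ω n ≤ t)
    (h2 : (t : ℝ≥0∞) < R.jumpTime ω (n + 1)) : R.process t ω = some (ω.1 n) := by
  classical
  have h : ∃ n : ℕ, R.jumpTime ω n ≤ t ∧ (t : ℝ≥0∞) < R.jumpTime ω (n + 1) := ⟨n, h1, h2⟩
  rw [process, dif_pos h]
  refine congrArg (fun k => some (ω.1 k)) ?_
  rw [Nat.find_eq_iff]
  refine ⟨⟨h1, h2⟩, fun m hm hm2 => ?_⟩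
  exact absurd (hm2.2.trans_le (R.jumpTime_mono ω hm)) h1.not_gt

theorem exists_of_process_eq_some {ω : PathSpace S} {t : ℝ≥0} {y : S}
    (h : R.process t ω = some y) :
    ∃ n : ℕ, R.jumpTime ω n ≤ t ∧ (t : ℝ≥0∞) < R.jumpTime ω (n + 1) ∧ ω.1 n = y := by
  classical
  rw [process] at h
  split_ifs at h with h1
  exact ⟨_, (Nat.find_spec h1).1, (Nat.find_spec h1).2, Option.some_injective _ h⟩

/-- `T_y` can only be a jump time at which the jump chain is in `y`. -/
theorem exists_jumpTime_eq {ω : PathSpace S} {t : ℝ≥0} {y : S} (ht : 0 < t)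
    (hne : ¬ ∀ᶠ s in 𝓝[<] t, R.process s ω = R.process t ω) (h : R.process t ω = some y) :
    ∃ n : ℕ, R.jumpTime ω (n + 1) = t ∧ ω.1 (n + 1) = y := by
  obtain ⟨n, h1, h2, rfl⟩ := R.exists_of_process_eq_some h
  have heq : R.jumpTime ω n = t := by
    refine le_antisymm h1 (not_lt.mp fun hlt => hne ?_)
    have hlt' : (R.jumpTime ω n).toNNReal < t := ENNReal.toNNReal_lt_of_lt_coe hlt
    filter_upwards [Ioo_mem_nhdsLT hlt'] with s hs
    rw [h]
    refine R.process_eq_some ?_ (lt_trans (ENNReal.coe_lt_coe.mpr hs.2) h2)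
    rw [← ENNReal.coe_toNNReal hlt.ne_top]
    exact ENNReal.coe_le_coe.mpr hs.1.le
  cases n with
  | zero =>
    rw [jumpTime_zero] at heq
    exact absurd (ENNReal.coe_eq_zero.mp heq.symm) ht.ne'
  | succ n => exact ⟨n, heq, rfl⟩

/-- The time spent by the path before the first return of the jump chain to the complement of
`A`. -/
noncomputable def stayTime (A : Set S) (ω : PathSpace S) : ℝ≥0∞ :=
  ∑' m, (stayEvent A m).indicator (fun X => (R.outRate (X m) : ℝ≥0∞)⁻¹) ω.1 *
    ENNReal.ofReal (ω.2 m)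

/-- A visit to the complement of `A` at step `n + 1` ends the killed path by the time of that
jump. -/
theorem stayTime_le_jumpTime {A : Set S} {ω : PathSpace S} {n : ℕ} (h : ω.1 (n + 1) ∉ A) :
    R.stayTime A ω ≤ R.jumpTime ω (n + 1) := by
  rw [stayTime, tsum_eq_sum (s := Finset.range (n + 1)), jumpTime]
  · refine Finset.sum_le_sum fun m _ => ?_
    rw [ENNReal.div_eq_inv_mul]
    gcongr
    exact Set.indicator_le_self' (fun _ _ => zero_le) _
  · intro m hm
    rw [Set.indicator_of_notMem, zero_mul]
    exact fun h2 => h (h2 n (by simpa using hm))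

theorem jumpTime_le_stayTime {A : Set S} {ω : PathSpace S} {n : ℕ}
    (h : ∀ i < n, ω.1 (i + 1) ∈ A) : R.jumpTime ω (n + 1) ≤ R.stayTime A ω := by
  refine le_trans (Finset.sum_le_sum fun m hm => ?_) (ENNReal.sum_le_tsum (Finset.range (n + 1)))
  rw [Set.indicator_of_mem, ENNReal.div_eq_inv_mul]
  exact fun i hi => h i (by have := Finset.mem_range.mp hm; omega)

theorem stayTime_le_hittingTime (y : S) (ω : PathSpace S) :
    R.stayTime {y}ᶜ ω ≤ R.hittingTime y ω := by
  refine le_iInf₂ fun t ht => ?_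
  obtain ⟨n, h1, h2⟩ := R.exists_jumpTime_eq ht.1 ht.2.1 ht.2.2
  rw [← h1]
  exact R.stayTime_le_jumpTime (by simpa using h2)

/-- A path that never returns has an infinite return time, also when it explodes. -/
theorem hittingTime_eq_top {y : S} {ω : PathSpace S} (h : ∀ n, ω.1 ∈ stayEvent {y}ᶜ n) :
    R.hittingTime y ω = ∞ := by
  refine top_le_iff.mp (le_iInf₂ fun t ht => ?_)
  obtain ⟨n, _, h2⟩ := R.exists_jumpTime_eq ht.1 ht.2.1 ht.2.2
  exact absurd h2 (h (n + 1) n n.lt_succ_self)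

theorem jumpTime_ne_top {ω : PathSpace S} (hq : ∀ x, R.outRate x ≠ 0) (n : ℕ) :
    R.jumpTime ω n ≠ ∞ :=
  ENNReal.sum_ne_top.mpr fun _ _ =>
    ENNReal.div_ne_top ENNReal.ofReal_ne_top (by simpa using hq _)

theorem jumpTime_lt_succ {ω : PathSpace S} (hq : ∀ x, R.outRate x ≠ 0) (hω : ∀ n, 0 < ω.2 n)
    (n : ℕ) : R.jumpTime ω n < R.jumpTime ω (n + 1) := by
  rw [jumpTime_succ]
  refine ENNReal.lt_add_right (R.jumpTime_ne_top hq n) ?_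
  exact (ENNReal.div_pos (ENNReal.ofReal_pos.mpr (hω n)).ne' ENNReal.coe_ne_top).ne'

/-- If all clocks are positive, the process is in a different state just before the first return of
the jump chain, so that this return is counted by `T_y`. -/
theorem hittingTime_le_stayTime {y : S} {ω : PathSpace S} (hq : ∀ x, R.outRate x ≠ 0)
    (hω : ∀ n, 0 < ω.2 n) (h1 : ω.1 1 ≠ y) (h : ∃ n, ω.1 ∉ stayEvent {y}ᶜ n) :
    R.hittingTime y ω ≤ R.stayTime {y}ᶜ ω := by
  classical
  have h' : ∃ n, ω.1 (n + 1) = y := by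
    obtain ⟨n, hn⟩ := h
    by_contra! h2
    exact hn fun i _ => h2 i
  set n := Nat.find h' with hn
  have hny : ω.1 (n + 1) = y := Nat.find_spec h'
  have hmin : ∀ i < n, ω.1 (i + 1) ≠ y := fun i hi => Nat.find_min h' hi
  refine le_trans ?_ (R.jumpTime_le_stayTime (n := n) fun i hi => hmin i hi)
  have hpred : ω.1 n ≠ y := by
    rcases Nat.eq_zero_or_pos n with h0 | hpos
    · rw [h0] at hny; exact absurd hny h1
    · obtain ⟨k, hk⟩ := Nat.exists_eq_add_of_lt hpos
      rw [zero_add] at hk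
      rw [hk]; exact hmin k (by omega)
  have hfin := fun k => R.jumpTime_ne_top (ω := ω) hq k
  set t := (R.jumpTime ω (n + 1)).toNNReal with ht
  have htc : (t : ℝ≥0∞) = R.jumpTime ω (n + 1) := ENNReal.coe_toNNReal (hfin _)
  have hlt : (R.jumpTime ω n).toNNReal < t :=
    (ENNReal.toNNReal_lt_toNNReal (hfin _) (hfin _)).mpr (R.jumpTime_lt_succ hq hω n)
  have hproc : R.process t ω = some y := by
    rw [← hny]
    exact R.process_eq_some htc.ge (htc ▸ R.jumpTime_lt_succ hq hω (n + 1))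
  rw [← htc]
  refine iInf₂_le t ⟨lt_of_le_of_lt zero_le hlt, fun hev => ?_, hproc⟩
  have : (𝓝[<] t).NeBot := nhdsLT_neBot_of_exists_lt ⟨_, hlt⟩
  obtain ⟨s, hs1, hs2⟩ := (hev.and (Ioo_mem_nhdsLT hlt)).exists
  rw [hproc, R.process_eq_some (n := n) ?_ ?_] at hs1
  · exact hpred (Option.some_injective _ hs1)
  · rw [← ENNReal.coe_toNNReal (hfin n)]
    exact ENNReal.coe_le_coe.mpr hs2.1.le
  · rw [← htc]; exact ENNReal.coe_lt_coe.mpr hs2.2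

end Paths

section Clocks

instance : IsProbabilityMeasure (expMeasure 1) := isProbabilityMeasure_expMeasure one_pos

/-- The exponential density times `t` is the density of the gamma law with shape `2`. -/
theorem lintegral_ofReal_expMeasure : ∫⁻ t, ENNReal.ofReal t ∂(expMeasure 1) = 1 := by
  rw [expMeasure, gammaMeasure, lintegral_withDensity_eq_lintegral_mul _ (by
    exact (measurable_gammaPDFReal 1 1).ennreal_ofReal) (by fun_prop)]
  rw [← lintegral_gammaPDF_eq_one (a := 2) (r := 1) two_pos one_pos]
  refine lintegral_congr fun t => ?_
  simp only [Pi.mul_apply, gammaPDF_eq]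
  split_ifs with ht
  · rw [← ENNReal.ofReal_mul (by positivity)]
    congr 1
    have : Real.Gamma 2 = 1 := Real.Gamma_two
    norm_num [this]
    ring
  · simp

theorem expMeasure_ae_pos : ∀ᵐ t ∂(expMeasure 1), 0 < t := by
  rw [ae_iff]
  simp only [not_lt]
  change expMeasure 1 (Set.Iic 0) = 0
  rw [expMeasure, gammaMeasure, withDensity_apply _ measurableSet_Iic,
    setLIntegral_congr Iio_ae_eq_Iic.symm, lintegral_gammaPDF_of_nonpos le_rfl]

variable {S : Type*} [Countable S] [MeasurableSpace S] [DiscreteMeasurableSpace S]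
  (R : TransitionRates S)

theorem pathLaw_ae_clock_pos (x : S) : ∀ᵐ ω ∂(R.pathLaw x), ∀ n, 0 < ω.2 n := by
  have h : ∀ᵐ e ∂(Measure.infinitePi fun _ : ℕ => expMeasure 1), ∀ n, 0 < e n := by
    rw [ae_all_iff]
    intro n
    exact (measurePreserving_eval_infinitePi (fun _ : ℕ => expMeasure 1)
      n).quasiMeasurePreserving.ae expMeasure_ae_pos
  exact Measure.quasiMeasurePreserving_snd.ae h

theorem pathLaw_ae_chain {x : S} {p : (ℕ → S) → Prop} (h : ∀ᵐ X ∂(R.chainLaw x), p X) :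
    ∀ᵐ ω ∂(R.pathLaw x), p ω.1 :=
  Measure.quasiMeasurePreserving_fst.ae h

theorem pathLaw_fst (x : S) (B : Set (ℕ → S)) :
    R.pathLaw x (Prod.fst ⁻¹' B) = R.chainLaw x B := by
  rw [← Set.prod_univ, pathLaw, Measure.prod_prod, measure_univ, mul_one]

theorem chainLaw_stayEvent (A : Set S) (x : S) (n : ℕ) :
    R.chainLaw x (stayEvent A n) = (R.stayOp A)^[n] 1 x := by
  rw [← lintegral_stayEvent, ← lintegral_indicator_one (measurableSet_stayEvent A n)]
  rfl

/-- The clocks have mean one and are independent of the chain, so that the mean sojourn times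
can be integrated along the chain alone. -/
theorem lintegral_stayTime (A : Set S) (x : S) : ∫⁻ ω, R.stayTime A ω ∂(R.pathLaw x) =
    ∑' n, (R.stayOp A)^[n] (fun z => (R.outRate z : ℝ≥0∞)⁻¹) x := by
  have hm : ∀ m, Measurable ((stayEvent A m).indicator
      (fun X : ℕ → S => (R.outRate (X m) : ℝ≥0∞)⁻¹)) := fun m =>
    Measurable.indicator ((measurable_of_countable fun z => (R.outRate z : ℝ≥0∞)⁻¹).comp
      (measurable_pi_apply m)) (measurableSet_stayEvent A m)
  unfold stayTime
  have hm2 : ∀ m, Measurable fun ω : PathSpace S => (stayEvent A m).indicator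
      (fun X : ℕ → S => (R.outRate (X m) : ℝ≥0∞)⁻¹) ω.1 * ENNReal.ofReal (ω.2 m) := fun m =>
    ((hm m).comp measurable_fst).mul (by fun_prop)
  rw [lintegral_tsum fun m => (hm2 m).aemeasurable]
  refine tsum_congr fun m => ?_
  rw [pathLaw, lintegral_prod_mul (hm m).aemeasurable
    (g := fun e : ℕ → ℝ => ENNReal.ofReal (e m))
    (ENNReal.measurable_ofReal.comp (measurable_pi_apply m)).aemeasurable]
  have h1 : ∫⁻ e : ℕ → ℝ, ENNReal.ofReal (e m)
      ∂(Measure.infinitePi fun _ : ℕ => expMeasure 1) = 1 := by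
    rw [← lintegral_ofReal_expMeasure]
    exact (measurePreserving_eval_infinitePi (fun _ : ℕ => expMeasure 1) m).lintegral_comp
      ENNReal.measurable_ofReal
  rw [h1, mul_one, ← lintegral_stayEvent]

theorem jumpKernel_singleton {x : S} (hx : R.outRate x ≠ 0) (z : S) :
    R.jumpKernel x {z} = ((R.q x z / R.outRate x : ℝ≥0) : ℝ≥0∞) := by
  refine (PMF.toMeasure_apply_singleton (R.jumpPMF x) z (MeasurableSet.singleton z)).trans ?_
  exact congrArg (fun p : PMF S => p z) (dif_neg hx)

theorem jumpKernel_self {y : S} (hy : R.outRate y ≠ 0) : R.jumpKernel y {y} = 0 := by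
  simp [R.jumpKernel_singleton hy, R.q_self]

theorem lintegral_hittingTime_lt_top {y : S} {κ : ℝ≥0} (hκ : 0 < κ) (hq : ∀ x, κ ≤ R.outRate x)
    (h : ∑' n, (R.stayOp {y}ᶜ)^[n] 1 y ≠ ∞) : ∫⁻ ω, R.hittingTime y ω ∂(R.pathLaw y) < ∞ := by
  have hq0 : ∀ x, R.outRate x ≠ 0 := fun x => (hκ.trans_le (hq x)).ne'
  have hret : ∀ᵐ X ∂(R.chainLaw y), ∃ n, X ∉ stayEvent {y}ᶜ n := by
    have h0 : R.chainLaw y (⋂ n, stayEvent {y}ᶜ n) = 0 := by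
      have ht : Filter.Tendsto (fun n => (R.stayOp {y}ᶜ)^[n] 1 y) Filter.atTop (𝓝 0) :=
        ENNReal.tendsto_atTop_zero_of_tsum_ne_top h
      refine le_antisymm (ge_of_tendsto' ht fun n => ?_) zero_le
      rw [← chainLaw_stayEvent]
      exact measure_mono (Set.iInter_subset _ n)
    filter_upwards [measure_eq_zero_iff_ae_notMem.mp h0] with X hX
    simpa using hX
  have h1 : ∀ᵐ X ∂(R.chainLaw y), X 1 ≠ y := by
    have h0 : R.chainLaw y (stayEvent {y} 1) = 0 := by
      rw [chainLaw_stayEvent]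
      simp [stayOp, R.jumpKernel_self (hq0 y)]
    filter_upwards [measure_eq_zero_iff_ae_notMem.mp h0] with X hX
    simpa [stayEvent] using hX
  calc ∫⁻ ω, R.hittingTime y ω ∂(R.pathLaw y) ≤ ∫⁻ ω, R.stayTime {y}ᶜ ω ∂(R.pathLaw y) := by
        refine lintegral_mono_ae ?_
        filter_upwards [R.pathLaw_ae_clock_pos y, R.pathLaw_ae_chain hret, R.pathLaw_ae_chain h1]
          with ω e1 e2 e3
        exact R.hittingTime_le_stayTime hq0 e1 e3 e2
    _ = ∑' n, (R.stayOp {y}ᶜ)^[n] (fun z => (R.outRate z : ℝ≥0∞)⁻¹) y := R.lintegral_stayTime _ _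
    _ ≤ ∑' n, (κ : ℝ≥0∞)⁻¹ * (R.stayOp {y}ᶜ)^[n] 1 y := by
        refine ENNReal.tsum_le_tsum fun n => ?_
        have hle : (fun z => (R.outRate z : ℝ≥0∞)⁻¹) ≤ (κ : ℝ≥0∞)⁻¹ • (1 : S → ℝ≥0∞) := fun z => by
          simpa using hq z
        have := R.stayOp_iterate_mono (A := {y}ᶜ) n hle y
        rwa [stayOp_iterate_smul] at this
    _ < ∞ := by
        rw [ENNReal.tsum_mul_left]
        exact ENNReal.mul_lt_top (by simpa using hκ) h.lt_top

theorem tsum_le_lintegral_hittingTime (y : S) :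
    ∑' n, (R.stayOp {y}ᶜ)^[n] (fun z => (R.outRate z : ℝ≥0∞)⁻¹) y ≤
      ∫⁻ ω, R.hittingTime y ω ∂(R.pathLaw y) := by
  rw [← lintegral_stayTime]
  exact lintegral_mono fun ω => R.stayTime_le_hittingTime y ω

/-- A finite mean return time makes the return almost sure. No measurability of the return time
is needed, as it is infinite on the measurable event that the chain never returns. -/
theorem tendsto_stayOp_of_lintegral_hittingTime {y : S}
    (h : ∫⁻ ω, R.hittingTime y ω ∂(R.pathLaw y) < ∞) :
    Filter.Tendsto (fun n => (R.stayOp {y}ᶜ)^[n] 1 y) Filter.atTop (𝓝 0) := by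
  have hmeas : MeasurableSet (⋂ n, stayEvent ({y}ᶜ : Set S) n) :=
    MeasurableSet.iInter fun n => measurableSet_stayEvent _ n
  have h0 : R.chainLaw y (⋂ n, stayEvent {y}ᶜ n) = 0 := by
    rw [← R.pathLaw_fst y]
    by_contra hne
    refine h.ne (top_le_iff.mp ?_)
    calc ∞ = ∫⁻ ω, (Prod.fst ⁻¹' ⋂ n, stayEvent ({y}ᶜ : Set S) n).indicator
          (fun _ => ∞) ω ∂(R.pathLaw y) := by
          rw [lintegral_indicator_const (hmeas.preimage measurable_fst), ENNReal.top_mul hne]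
      _ ≤ _ := by
          refine lintegral_mono fun ω => Set.indicator_le (fun ω hω => ?_) ω
          rw [R.hittingTime_eq_top (Set.mem_iInter.mp hω)]
  simp only [← chainLaw_stayEvent]
  rw [← h0]
  refine tendsto_measure_iInter_atTop
    (fun n => (measurableSet_stayEvent _ n).nullMeasurableSet) ?_ ⟨0, measure_ne_top _ _⟩
  exact fun m n hmn X hX i hi => hX i (hi.trans_le hmn)

/-- As every sojourn contains a rational time, one of countably many fixed times sees the
process in `y` with positive probability. -/
theorem isIrreducible_of_reach (hq : ∀ x, R.outRate x ≠ 0)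
    (h : ∀ x y, Relation.ReflTransGen (fun u v => R.jumpKernel u {v} ≠ 0) x y) :
    R.IsIrreducible := by
  intro x y
  obtain ⟨n, hn⟩ := R.exists_stayOp_univ_iterate_pos (h x y)
  by_contra! hcon
  have hnull : R.pathLaw x (⋃ r : ℚ, {ω | R.process (r : ℝ).toNNReal ω = some y}) = 0 :=
    measure_iUnion_null fun r => le_antisymm (hcon _) zero_le
  have hsub : R.pathLaw x (Prod.fst ⁻¹' ((fun X : ℕ → S => X n) ⁻¹' {y})) = 0 := by
    rw [measure_eq_zero_iff_ae_notMem] at hnull ⊢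
    filter_upwards [hnull, R.pathLaw_ae_clock_pos x] with ω h1 h2 h3
    have hfin := fun k => R.jumpTime_ne_top (ω := ω) hq k
    have hlt := (ENNReal.toReal_lt_toReal (hfin _) (hfin _)).mpr (R.jumpTime_lt_succ hq h2 n)
    obtain ⟨r, hr1, hr2⟩ := exists_rat_btwn hlt
    have hr0 : (0 : ℝ) ≤ r := ENNReal.toReal_nonneg.trans hr1.le
    refine h1 (Set.mem_iUnion.mpr ⟨r, ?_⟩)
    change R.process _ ω = some y
    rw [← (show ω.1 n = y from h3)]
    refine R.process_eq_some ?_ ?_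
    · exact (ENNReal.le_ofReal_iff_toReal_le (hfin _) hr0).mpr hr1.le
    · exact (ENNReal.ofReal_lt_iff_lt_toReal hr0 (hfin _)).mpr hr2
  have hB : MeasurableSet ((fun X : ℕ → S => X n) ⁻¹' {y}) :=
    (MeasurableSet.singleton y).preimage (measurable_pi_apply n)
  rw [R.pathLaw_fst x] at hsub
  refine hn ?_
  rw [← lintegral_stayEvent, ← hsub, ← lintegral_indicator_one hB]
  refine lintegral_congr fun X => ?_
  simp [stayEvent, Set.indicator]
  rfl

end Clocks

end TransitionRates

/-! ### The killed kernel along single steps -/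

namespace TransitionRates

variable {S : Type*} [Countable S] [MeasurableSpace S] [DiscreteMeasurableSpace S]
  (R : TransitionRates S)

theorem lintegral_jumpKernel {x : S} (hx : R.outRate x ≠ 0) (f : S → ℝ≥0∞) :
    ∫⁻ z, f z ∂(R.jumpKernel x) = (∑' z, R.q x z * f z) / R.outRate x := by
  rw [lintegral_countable', ENNReal.div_eq_inv_mul, ← ENNReal.tsum_mul_left]
  refine tsum_congr fun z => ?_
  rw [R.jumpKernel_singleton hx, ENNReal.coe_div hx, ENNReal.div_eq_inv_mul]
  ring

theorem jumpKernel_singleton_ne_zero {x z : S} (hx : R.outRate x ≠ 0) (hz : R.q x z ≠ 0) :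
    R.jumpKernel x {z} ≠ 0 := by
  rw [R.jumpKernel_singleton hx]
  simp [hx, hz]

/-- On entering `y` the killed process may be credited with the value `f y`: the killed operator
then differs from the transition operator only by the constant `f y` on survival. -/
theorem stayOp_compl_singleton_add (y x : S) (f : S → ℝ≥0∞) :
    R.stayOp {y}ᶜ f x + f y = ∫⁻ z, f z ∂(R.jumpKernel x) + f y * R.stayOp {y}ᶜ 1 x := by
  have h1 : R.jumpKernel x {y} + R.stayOp {y}ᶜ 1 x = 1 := by
    simpa [stayOp] using measure_add_measure_compl (μ := R.jumpKernel x)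
      (MeasurableSet.singleton y)
  have h2 : ∫⁻ z, f z ∂(R.jumpKernel x) = f y * R.jumpKernel x {y} + R.stayOp {y}ᶜ f x := by
    rw [← lintegral_add_compl f (MeasurableSet.singleton y), lintegral_singleton, stayOp]
  calc R.stayOp {y}ᶜ f x + f y
      = R.stayOp {y}ᶜ f x + f y * (R.jumpKernel x {y} + R.stayOp {y}ᶜ 1 x) := by rw [h1, mul_one]
    _ = _ := by rw [h2]; ring

theorem stayOp_iterate_le_of_step {A : Set S} {x z : S} (hz : z ∈ A)
    (hxz : R.jumpKernel x {z} ≠ 0) (f : S → ℝ≥0∞) (n : ℕ) :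
    (R.stayOp A)^[n] f z ≤ (R.jumpKernel x {z})⁻¹ * (R.stayOp A)^[n + 1] f x := by
  rw [Function.iterate_succ_apply', mul_comm, ← div_eq_mul_inv,
    ENNReal.le_div_iff_mul_le (Or.inl hxz) (Or.inl (measure_ne_top _ _))]
  exact R.mul_jumpKernel_le_stayOp hz _ x

theorem tsum_stayOp_ne_top_of_step {A : Set S} {x z : S} (hz : z ∈ A)
    (hxz : R.jumpKernel x {z} ≠ 0) {f : S → ℝ≥0∞} (h : ∑' n, (R.stayOp A)^[n] f x ≠ ∞) :
    ∑' n, (R.stayOp A)^[n] f z ≠ ∞ := by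
  refine ne_top_of_le_ne_top (ENNReal.mul_ne_top (ENNReal.inv_ne_top.mpr hxz) h) ?_
  refine (ENNReal.tsum_le_tsum fun n => R.stayOp_iterate_le_of_step hz hxz f n).trans ?_
  rw [ENNReal.tsum_mul_left]
  exact mul_le_mul_right (ENNReal.tsum_comp_le_tsum_of_injective (add_left_injective 1)
    fun n => (R.stayOp A)^[n] f x) _

theorem tendsto_stayOp_of_step {A : Set S} {x z : S} (hz : z ∈ A)
    (hxz : R.jumpKernel x {z} ≠ 0) {f : S → ℝ≥0∞}
    (h : Filter.Tendsto (fun n => (R.stayOp A)^[n] f x) Filter.atTop (𝓝 0)) :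
    Filter.Tendsto (fun n => (R.stayOp A)^[n] f z) Filter.atTop (𝓝 0) := by
  have h1 : Filter.Tendsto (fun n => (R.jumpKernel x {z})⁻¹ * (R.stayOp A)^[n + 1] f x)
      Filter.atTop (𝓝 ((R.jumpKernel x {z})⁻¹ * 0)) :=
    ENNReal.Tendsto.const_mul ((Filter.tendsto_add_atTop_iff_nat 1).mpr h)
      (Or.inr (ENNReal.inv_ne_top.mpr hxz))
  rw [mul_zero] at h1
  exact tendsto_of_tendsto_of_tendsto_of_le_of_le tendsto_const_nhds h1 (fun _ => zero_le)
    fun n => R.stayOp_iterate_le_of_step hz hxz f n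

end TransitionRates

/-! ### The Poisson equation of the M/M/1 queue -/

section Poisson

/-- The Poisson equation of the M/M/1 queue with arrival rate `m₁` and service rate `m₂`, for the
increments `d` of the unknown function. The solution taken here is the one given by the tail sums of
`l`, which is bounded below in terms of `l` and constant beyond the support of `l`. -/
theorem exists_poisson {m₁ m₂ : ℝ} (h1 : 0 < m₁) (h2 : m₁ < m₂) {l : ℕ → ℝ} (hl : ∀ i, 0 ≤ l i)
    (hs : Summable fun i => (m₁ / m₂) ^ i * l i) {c : ℝ}
    (hc : c = (1 - m₁ / m₂) * ∑' i, (m₁ / m₂) ^ i * l i) :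
    ∃ d : ℕ → ℝ, m₁ * d 0 = c - l 0 ∧ (∀ j, m₁ * d (j + 1) - m₂ * d j = c - l (j + 1)) ∧
      (∀ j, l (j + 1) - c * m₂ / (m₂ - m₁) ≤ m₂ * d j) ∧
      ∀ j, (∀ i, j < i → l i = 0) → m₂ * d j = -(c * m₂ / (m₂ - m₁)) := by
  have h3 : 0 < m₂ := h1.trans h2
  -- With `a = c ρ / (1 - ρ)`, the solution is `m₁ d j = G j - a` for the tail sums `G`.
  have h4 : m₂ - m₁ ≠ 0 := (sub_pos.mpr h2).ne'
  set ρ := m₁ / m₂ with hρ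
  have hρ0 : 0 < ρ := div_pos h1 h3
  set G : ℕ → ℝ := fun j => ∑' k, ρ ^ (k + 1) * l (j + k + 1) with hG
  have hsum : ∀ j, Summable fun k => ρ ^ (k + 1) * l (j + k + 1) := fun j => by
    refine (((summable_nat_add_iff (j + 1)).mpr hs).mul_left (ρ ^ j)⁻¹).congr fun k => ?_
    rw [show k + (j + 1) = j + k + 1 by ring, show j + k + 1 = j + (k + 1) by ring, pow_add]
    field_simp
  have hrec : ∀ j, G j = ρ * l (j + 1) + ρ * G (j + 1) := fun j => by
    simp only [hG]
    rw [(hsum j).tsum_eq_zero_add, ← tsum_mul_left]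
    congr 1
    · simp
    · refine tsum_congr fun k => ?_
      rw [show j + (k + 1) + 1 = j + 1 + k + 1 by ring]
      ring
  have hG0 : ∑' i, ρ ^ i * l i = l 0 + G 0 := by
    rw [hs.tsum_eq_zero_add]
    simp [hG]
  have hGnn : ∀ j, 0 ≤ G j := fun j => tsum_nonneg fun k => mul_nonneg (by positivity) (hl _)
  refine ⟨fun j => (G j - c * ρ * m₂ / (m₂ - m₁)) / m₁,
    ?_, fun j => ?_, fun j => ?_, fun j hj => ?_⟩
  · have : G 0 = c * m₂ / (m₂ - m₁) - l 0 := by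
      rw [hc, hG0, hρ]; field_simp; ring
    simp only [this]
    rw [hρ]; field_simp; ring
  · have := hrec j
    simp only [this]
    rw [hρ]; field_simp; ring
  · have h5 := hrec j
    have h6 := hGnn (j + 1)
    simp only [h5]
    have : m₂ * ((ρ * l (j + 1) + ρ * G (j + 1) - c * ρ * m₂ / (m₂ - m₁)) / m₁) =
        l (j + 1) + G (j + 1) - c * m₂ / (m₂ - m₁) := by
      rw [hρ]; field_simp
    rw [this]
    linarith
  · have : G j = 0 := by
      simp only [hG]
      rw [tsum_congr (g := fun _ => (0 : ℝ)) fun k => by rw [hj _ (by omega), mul_zero], tsum_zero]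
    simp only [this]
    rw [hρ]; field_simp; ring

theorem sum_range_le_of_eventually_nonpos {d : ℕ → ℝ} {N : ℕ} (hd : ∀ i, N ≤ i → d i ≤ 0) (j : ℕ) :
    ∑ i ∈ Finset.range j, d i ≤ ∑ i ∈ Finset.range N, |d i| := by
  induction j with
  | zero => simpa using Finset.sum_nonneg fun i _ => abs_nonneg (d i)
  | succ j ih =>
    rcases le_or_gt N j with h | h
    · rw [Finset.sum_range_succ]; linarith [hd j h]
    · calc _ ≤ ∑ i ∈ Finset.range (j + 1), |d i| := Finset.sum_le_sum fun i _ => le_abs_self _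
        _ ≤ _ := Finset.sum_le_sum_of_subset_of_nonneg (Finset.range_mono h)
          fun i _ _ => abs_nonneg _

end Poisson

/-! ### The tandem network -/

section Tandem

variable (lam : ℕ → ℝ≥0) (μ₁ μ₂ : ℝ≥0)

theorem tandem_tsum_q_mul (x : ℕ × ℕ) (f : ℕ × ℕ → ℝ≥0∞) :
    ∑' y, ((tandemSystem lam μ₁ μ₂).q x y : ℝ≥0∞) * f y =
      lam x.2 * f (x.1 + 1, x.2) + (if 0 < x.1 then μ₁ * f (x.1 - 1, x.2 + 1) else 0) +
      (if 0 < x.2 then μ₂ * f (x.1, x.2 - 1) else 0) := by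
  have hq : ∀ y, ((tandemSystem lam μ₁ μ₂).q x y : ℝ≥0∞) * f y =
      (if y = (x.1 + 1, x.2) then lam x.2 * f (x.1 + 1, x.2) else 0) +
      (if y = (x.1 - 1, x.2 + 1) then (if 0 < x.1 then μ₁ * f (x.1 - 1, x.2 + 1) else 0) else 0) +
      (if y = (x.1, x.2 - 1) then (if 0 < x.2 then μ₂ * f (x.1, x.2 - 1) else 0) else 0) := by
    rintro ⟨y1, y2⟩
    obtain ⟨x1, x2⟩ := x
    simp only [tandemSystem, tandemRate, Prod.mk.injEq]
    by_cases h1 : y1 = x1 + 1 ∧ y2 = x2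
    · obtain ⟨rfl, rfl⟩ := h1
      simp
    by_cases h2 : y1 + 1 = x1 ∧ y2 = x2 + 1
    · obtain ⟨rfl, rfl⟩ := h2
      simp
    by_cases h3 : y1 = x1 ∧ y2 + 1 = x2
    · obtain ⟨rfl, rfl⟩ := h3
      have e1 : ¬ (y1 = y1 - 1 ∧ y2 = y2 + 1 + 1) := by omega
      simp [e1]
    rw [if_neg h1, if_neg h2, if_neg h3, if_neg h1]
    have e1 : (if y1 = x1 - 1 ∧ y2 = x2 + 1 then
        (if 0 < x1 then (μ₁ : ℝ≥0∞) * f (x1 - 1, x2 + 1) else 0) else 0) = 0 := by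
      split_ifs with i1 i2 <;> first | rfl | omega
    have e2 : (if y1 = x1 ∧ y2 = x2 - 1 then
        (if 0 < x2 then (μ₂ : ℝ≥0∞) * f (x1, x2 - 1) else 0) else 0) = 0 := by
      split_ifs with i1 i2 <;> first | rfl | omega
    rw [e1, e2]; simp
  simp only [hq]
  rw [ENNReal.tsum_add, ENNReal.tsum_add, tsum_ite_eq, tsum_ite_eq, tsum_ite_eq]

theorem tandem_outRate (x : ℕ × ℕ) : (tandemSystem lam μ₁ μ₂).outRate x =
    lam x.2 + (if 0 < x.1 then μ₁ else 0) + (if 0 < x.2 then μ₂ else 0) := by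
  rw [← ENNReal.coe_inj, TransitionRates.outRate, ENNReal.coe_tsum (TransitionRates.summable_q _ x)]
  have := tandem_tsum_q_mul lam μ₁ μ₂ x 1
  simp only [Pi.one_apply, mul_one] at this
  rw [this]
  split_ifs <;> simp

/-- The generator of the tandem network, acting on real functions. For `x.1 = 0` or `x.2 = 0` the
truncated subtraction is harmless, as the corresponding term is absent. -/
noncomputable def tandemGen (v : ℕ × ℕ → ℝ) (x : ℕ × ℕ) : ℝ :=
  lam x.2 * (v (x.1 + 1, x.2) - v x) + (if 0 < x.1 then μ₁ * (v (x.1 - 1, x.2 + 1) - v x) else 0) +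
    (if 0 < x.2 then μ₂ * (v (x.1, x.2 - 1) - v x) else 0)

theorem add_tandemGen_div {x : ℕ × ℕ} (hx : (tandemSystem lam μ₁ μ₂).outRate x ≠ 0)
    (v : ℕ × ℕ → ℝ) : v x + tandemGen lam μ₁ μ₂ v x / (tandemSystem lam μ₁ μ₂).outRate x =
      (lam x.2 * v (x.1 + 1, x.2) + (if 0 < x.1 then μ₁ * v (x.1 - 1, x.2 + 1) else 0) +
        (if 0 < x.2 then μ₂ * v (x.1, x.2 - 1) else 0)) / (tandemSystem lam μ₁ μ₂).outRate x := by
  have hq : ((tandemSystem lam μ₁ μ₂).outRate x : ℝ) =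
      lam x.2 + (if 0 < x.1 then (μ₁ : ℝ) else 0) + (if 0 < x.2 then (μ₂ : ℝ) else 0) := by
    rw [tandem_outRate]; split_ifs <;> simp
  have hne : ((tandemSystem lam μ₁ μ₂).outRate x : ℝ) ≠ 0 := by exact_mod_cast hx
  rw [eq_div_iff hne, add_mul, div_mul_cancel₀ _ hne, hq, tandemGen]
  split_ifs <;> ring

theorem add_tandemGen_div_nonneg {x : ℕ × ℕ} (hx : (tandemSystem lam μ₁ μ₂).outRate x ≠ 0)
    {v : ℕ × ℕ → ℝ} (hv : ∀ x, 0 ≤ v x) :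
    0 ≤ v x + tandemGen lam μ₁ μ₂ v x / (tandemSystem lam μ₁ μ₂).outRate x := by
  have hnn : ∀ (r : ℝ≥0) (z : ℕ × ℕ), 0 ≤ r * v z := fun r z => mul_nonneg r.coe_nonneg (hv z)
  rw [add_tandemGen_div _ _ _ hx]
  refine div_nonneg (add_nonneg (add_nonneg (hnn _ _) ?_) ?_) (NNReal.coe_nonneg _) <;>
    split_ifs <;> simp [hnn]

theorem tandem_lintegral_ofReal {x : ℕ × ℕ} (hx : (tandemSystem lam μ₁ μ₂).outRate x ≠ 0)
    {v : ℕ × ℕ → ℝ} (hv : ∀ x, 0 ≤ v x) :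
    ∫⁻ z, ENNReal.ofReal (v z) ∂((tandemSystem lam μ₁ μ₂).jumpKernel x) =
      ENNReal.ofReal (v x + tandemGen lam μ₁ μ₂ v x / (tandemSystem lam μ₁ μ₂).outRate x) := by
  have hpos : (0 : ℝ) < (tandemSystem lam μ₁ μ₂).outRate x := by
    exact_mod_cast pos_iff_ne_zero.mpr hx
  have hmul : ∀ (r : ℝ≥0) (z : ℕ × ℕ), (r : ℝ≥0∞) * ENNReal.ofReal (v z) =
      ENNReal.ofReal (r * v z) := fun r z => by
    rw [ENNReal.ofReal_mul r.coe_nonneg, ENNReal.ofReal_coe_nnreal]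
  have hite : ∀ (p : Prop) [Decidable p] (t : ℝ), (if p then ENNReal.ofReal t else 0) =
      ENNReal.ofReal (if p then t else 0) := fun p _ t => by split_ifs <;> simp
  have hnn : ∀ (r : ℝ≥0) (z : ℕ × ℕ), 0 ≤ r * v z := fun r z => mul_nonneg r.coe_nonneg (hv z)
  have hnn' : ∀ (p : Prop) [Decidable p] (r : ℝ≥0) (z : ℕ × ℕ), 0 ≤ if p then r * v z else 0 :=
    fun p _ r z => by split_ifs <;> simp [hnn]
  rw [TransitionRates.lintegral_jumpKernel _ hx, tandem_tsum_q_mul, add_tandemGen_div _ _ _ hx,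
    ENNReal.ofReal_div_of_pos hpos, ENNReal.ofReal_coe_nnreal,
    ENNReal.ofReal_add (add_nonneg (hnn _ _) (hnn' _ _ _)) (hnn' _ _ _),
    ENNReal.ofReal_add (hnn _ _) (hnn' _ _ _)]
  simp only [hmul, hite]

variable {lam μ₁ μ₂}

theorem tandem_exists_le_outRate (h0 : 0 < lam 0) (h1 : 0 < μ₁) (h2 : 0 < μ₂) :
    ∃ κ : ℝ≥0, 0 < κ ∧ ∀ x, κ ≤ (tandemSystem lam μ₁ μ₂).outRate x := by
  refine ⟨min (lam 0) (min μ₁ μ₂), by positivity, fun ⟨x1, x2⟩ => ?_⟩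
  rw [tandem_outRate]
  dsimp only
  rcases Nat.eq_zero_or_pos x2 with rfl | hx2
  · rw [add_assoc]
    exact (min_le_left _ _).trans le_self_add
  · rw [if_pos hx2]
    exact ((min_le_right _ _).trans (min_le_right _ _)).trans le_add_self

theorem tandem_reach (h0 : 0 < lam 0) (h1 : 0 < μ₁) (h2 : 0 < μ₂) (x y : ℕ × ℕ) :
    Relation.TransGen (fun u v => (tandemSystem lam μ₁ μ₂).jumpKernel u {v} ≠ 0) x y := by
  obtain ⟨κ, hκ, hq⟩ := tandem_exists_le_outRate h0 h1 h2
  have hne : ∀ x, (tandemSystem lam μ₁ μ₂).outRate x ≠ 0 := fun x => (hκ.trans_le (hq x)).ne'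
  set r := fun u v => (tandemSystem lam μ₁ μ₂).jumpKernel u {v} ≠ 0 with hr
  have hup : ∀ a, r (a, 0) (a + 1, 0) := fun a =>
    TransitionRates.jumpKernel_singleton_ne_zero _ (hne _) (by
      simp [tandemSystem, tandemRate, h0.ne'])
  have hmove : ∀ a b, r (a + 1, b) (a, b + 1) := fun a b =>
    TransitionRates.jumpKernel_singleton_ne_zero _ (hne _) (by
      simp [tandemSystem, tandemRate, h1.ne'])
  have hdown : ∀ a b, r (a, b + 1) (a, b) := fun a b =>
    TransitionRates.jumpKernel_singleton_ne_zero _ (hne _) (by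
      simp [tandemSystem, tandemRate, h2.ne'])
  have c1 : ∀ b a, Relation.ReflTransGen r (a, b) (a, 0) := fun b a => by
    induction b with
    | zero => exact .refl
    | succ b ih => exact .head (hdown a b) ih
  have c2 : ∀ a, Relation.ReflTransGen r (a, 0) (0, 0) := fun a => by
    induction a with
    | zero => exact .refl
    | succ a ih => exact .head (hmove a 0) ((c1 1 a).trans ih)
  have c3 : ∀ a, Relation.ReflTransGen r (0, 0) (a, 0) := fun a => by
    induction a with
    | zero => exact .refl
    | succ a ih => exact .tail ih (hup a)
  have c4 : ∀ b a, Relation.ReflTransGen r (a + b, 0) (a, b) := fun b a => by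
    induction b generalizing a with
    | zero => exact .refl
    | succ b ih =>
      refine .tail ?_ (hmove a b)
      have := ih (a + 1)
      rwa [show a + 1 + b = a + (b + 1) by ring] at this
  have d1 : Relation.ReflTransGen r x (0, 0) := (c1 x.2 x.1).trans (c2 x.1)
  have d2 : Relation.ReflTransGen r (1, 0) y :=
    (c2 1).trans ((c3 (y.1 + y.2)).trans (c4 y.2 y.1))
  exact Relation.TransGen.trans_left (Relation.TransGen.tail' d1 (hup 0)) d2

/-- A drift of at most `-q` off a finite set is a drift of at most `-1` for the jump chain. -/
theorem tandem_isStable_of_drift (h0 : 0 < lam 0) (h1 : 0 < μ₁) (h2 : 0 < μ₂)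
    {v : ℕ × ℕ → ℝ} (hv : ∀ x, 0 ≤ v x) {F : Set (ℕ × ℕ)} (hF : F.Finite)
    (hdrift : ∀ x ∉ F, tandemGen lam μ₁ μ₂ v x ≤ -(tandemSystem lam μ₁ μ₂).outRate x) :
    IsStableSystem lam μ₁ μ₂ := by
  obtain ⟨κ, hκ, hq⟩ := tandem_exists_le_outRate h0 h1 h2
  have hne : ∀ x, (tandemSystem lam μ₁ μ₂).outRate x ≠ 0 := fun x => (hκ.trans_le (hq x)).ne'
  refine ⟨TransitionRates.isIrreducible_of_reach _ hne fun x y =>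
    (tandem_reach h0 h1 h2 x y).to_reflTransGen, fun y => Or.inr ?_⟩
  refine TransitionRates.lintegral_hittingTime_lt_top _ hκ hq ?_
  refine TransitionRates.tsum_stayOp_iterate_one_ne_top _ hF
    (fun x _ => TransitionRates.exists_stayOp_iterate_one_lt_one _ (tandem_reach h0 h1 h2 x y))
    (fun x => ENNReal.ofReal (v x)) (fun x => ENNReal.ofReal_ne_top)
    (fun x _ => ?_) (fun x hx => ?_) y
  · rw [tandem_lintegral_ofReal _ _ _ (hne x) hv]
    exact ENNReal.ofReal_ne_top
  · have hpos : (0 : ℝ) < (tandemSystem lam μ₁ μ₂).outRate x := by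
      exact_mod_cast hκ.trans_le (hq x)
    have hd : tandemGen lam μ₁ μ₂ v x / (tandemSystem lam μ₁ μ₂).outRate x ≤ -1 := by
      rw [div_le_iff₀ hpos]; linarith [hdrift x hx]
    rw [tandem_lintegral_ofReal _ _ _ (hne x) hv]
    rw [← ENNReal.ofReal_one,
      ← ENNReal.ofReal_add (add_tandemGen_div_nonneg _ _ _ (hne x) hv) zero_le_one]
    exact ENNReal.ofReal_le_ofReal (by linarith)

end Tandem

/-! ### Stability -/

section Stability

variable {lam : ℕ → ℝ≥0} {μ₁ μ₂ : ℝ≥0}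

theorem tandem_isStable (h0 : 0 < lam 0) (h1 : 0 < μ₁) (h2 : μ₁ < μ₂)
    (hs : Summable fun i => ((μ₁ : ℝ) / μ₂) ^ i * lam i)
    (hlt : (1 - (μ₁ : ℝ) / μ₂) * ∑' i, ((μ₁ : ℝ) / μ₂) ^ i * lam i < μ₁) :
    IsStableSystem lam μ₁ μ₂ := by
  have r1 : (0 : ℝ) < μ₁ := h1
  have r2 : (μ₁ : ℝ) < μ₂ := h2
  have r3 : (0 : ℝ) < μ₂ := r1.trans r2
  set ρ : ℝ := (μ₁ : ℝ) / μ₂ with hρ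
  have hρ0 : 0 < ρ := div_pos r1 r3
  have hρ1 : ρ < 1 := (div_lt_one r3).mpr r2
  have hid : Summable fun i : ℕ => ρ ^ i * (i : ℝ) := by
    refine (summable_pow_mul_geometric_of_norm_lt_one 1
      (by rwa [Real.norm_of_nonneg hρ0.le])).congr fun i => ?_
    ring
  set c₀ := (1 - ρ) * ∑' i, ρ ^ i * (lam i : ℝ) with hc₀
  set m := (1 - ρ) * ∑' i : ℕ, ρ ^ i * (i : ℝ) with hm
  have hc₀0 : 0 ≤ c₀ := mul_nonneg (by linarith) (tsum_nonneg fun i => by positivity)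
  have hm0 : 0 ≤ m := mul_nonneg (by linarith) (tsum_nonneg fun i => by positivity)
  -- `δ` makes up half of the gap between `E λ(Z)` and `μ₁`.
  obtain ⟨δ, hδ, hδlt⟩ : ∃ δ : ℝ, 0 < δ ∧ (1 + δ) * c₀ + δ * m < μ₁ := by
    refine ⟨(μ₁ - c₀) / (2 * (c₀ + m + 1)), div_pos (by linarith) (by linarith), ?_⟩
    have : (μ₁ - c₀) / (2 * (c₀ + m + 1)) * (c₀ + m) ≤ (μ₁ - c₀) / 2 := by
      rw [div_mul_eq_mul_div, div_le_div_iff₀ (by linarith) two_pos]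
      nlinarith
    linarith
  set l : ℕ → ℝ := fun i => (1 + δ) * lam i + δ * i with hl
  have hl0 : ∀ i, 0 ≤ l i := fun i => by positivity
  have hle : ∀ i, ρ ^ i * l i = (1 + δ) * (ρ ^ i * lam i) + δ * (ρ ^ i * i) := fun i => by
    simp only [hl]; ring
  have hls : Summable fun i => ρ ^ i * l i := by
    simp only [hle]
    exact (hs.mul_left _).add (hid.mul_left _)
  obtain ⟨d, hd0, hdS, hdlow, -⟩ := exists_poisson r1 r2 hl0 hls
    (c := (1 + δ) * c₀ + δ * m) (by
      simp only [← hρ, hle]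
      rw [(hs.mul_left _).tsum_add (hid.mul_left _), tsum_mul_left, tsum_mul_left, hc₀, hm]
      ring)
  set c := (1 + δ) * c₀ + δ * m with hc
  set a := c * μ₂ / (μ₂ - μ₁) with ha
  set ε := min δ ((μ₁ - c) / (μ₁ + μ₂)) with hε
  have hε0 : 0 < ε := lt_min hδ (div_pos (by linarith) (by linarith))
  have hεδ : ε ≤ δ := min_le_left _ _
  have hεc : ε * (μ₁ + μ₂) ≤ μ₁ - c := by
    rw [← le_div_iff₀ (by linarith)]; exact min_le_right _ _
  obtain ⟨N, hN⟩ := exists_nat_ge ((a + ε * μ₂) / δ)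
  rw [div_le_iff₀ hδ] at hN
  have hN' : ∀ j : ℕ, N ≤ j → a + ε * μ₂ ≤ δ * j := fun j hj => by
    have : (N : ℝ) ≤ j := by exact_mod_cast hj
    nlinarith
  have hεμ : 0 < ε * μ₂ := mul_pos hε0 r3
  -- The increments `d` are nonnegative from `N` on, so adding `B` makes the test function
  -- nonnegative.
  set B := ∑ i ∈ Finset.range N, |(-d i)| with hB
  have hh : ∀ j, 0 ≤ ∑ i ∈ Finset.range j, d i + B := fun j => by
    have := sum_range_le_of_eventually_nonpos (d := fun i => -d i) (N := N) (fun i hi => by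
      have e1 := hdlow i
      have e2 := hN' (i + 1) (by omega)
      have e3 : (0 : ℝ) ≤ (1 + δ) * lam (i + 1) := by positivity
      simp only [hl] at e1
      have : 0 ≤ μ₂ * d i := by linarith
      have := nonneg_of_mul_nonneg_right this r3
      linarith) j
    rw [Finset.sum_neg_distrib] at this
    linarith
  refine tandem_isStable_of_drift h0 h1 (h1.trans h2)
    (v := fun x => (x.1 + (∑ i ∈ Finset.range x.2, d i + B)) / ε)
    (fun x => div_nonneg (add_nonneg (Nat.cast_nonneg _) (hh _)) hε0.le)
    (F := {0} ×ˢ Set.Iic N) ((Set.finite_singleton 0).prod (Set.finite_Iic N)) ?_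
  rintro ⟨x1, x2⟩ hx
  have hlamε : ∀ j, ε * lam j ≤ δ * lam j := fun j =>
    mul_le_mul_of_nonneg_right hεδ (lam j).coe_nonneg
  rw [← mul_le_mul_iff_right₀ hε0, tandem_outRate]
  rcases x1 with _ | x1
  · -- node 1 is empty: the drift is at most `-δ λ(j) - δ j + a`, where `a` is a constant
    rcases x2 with _ | j
    · simp at hx
    · have hj : N ≤ j + 1 := by
        by_contra h
        exact hx (by simp; omega)
      have e1 := hdlow j
      have e2 := hN' (j + 1) hj
      have e3 := hlamε (j + 1)
      simp only [hl] at e1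
      simp only [tandemGen, Finset.sum_range_succ]
      simp only [lt_self_iff_false, if_false, Nat.succ_pos, if_true, Nat.add_sub_cancel]
      push_cast at *
      field_simp
      linarith
  · -- node 1 is busy: the drift is `c - μ₁ - δ λ(j) - δ j`
    rcases x2 with _ | j
    · have e3 := hlamε 0
      simp only [hl] at hd0
      simp only [tandemGen, Finset.sum_range_succ]
      simp only [lt_self_iff_false, if_false, Nat.succ_pos, if_true, Nat.add_sub_cancel]
      push_cast at *
      field_simp
      simp only [Finset.sum_range_zero]
      linarith
    · have e3 := hlamε (j + 1)
      have e4 := hdS j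
      have e5 : (0 : ℝ) ≤ δ * (j + 1) := by positivity
      simp only [hl] at e4
      simp only [tandemGen, Finset.sum_range_succ]
      simp only [Nat.succ_pos, if_true, Nat.add_sub_cancel]
      push_cast at *
      field_simp
      linarith

end Stability

/-! ### Instability -/

section Instability

variable {lam : ℕ → ℝ≥0} {μ₁ μ₂ : ℝ≥0}

theorem tandem_stayOp_iterate_eq_zero (hne : ∀ x, (tandemSystem lam μ₁ μ₂).outRate x ≠ 0)
    (A : Set (ℕ × ℕ)) {M : ℕ} {f : ℕ × ℕ → ℝ≥0∞} (hf : ∀ z, z.1 < M → f z = 0) (k : ℕ) :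
    ∀ x : ℕ × ℕ, x.1 + k < M → ((tandemSystem lam μ₁ μ₂).stayOp A)^[k] f x = 0 := by
  induction k with
  | zero => exact fun x hx => hf x hx
  | succ k ih =>
    intro x hx
    rw [Function.iterate_succ_apply']
    refine le_antisymm ((TransitionRates.stayOp_le_lintegral _ _ _ _).trans ?_) zero_le
    rw [TransitionRates.lintegral_jumpKernel _ (hne x), tandem_tsum_q_mul,
      ih (x.1 + 1, x.2) (by dsimp only; omega), ih (x.1 - 1, x.2 + 1) (by dsimp only; omega),
      ih (x.1, x.2 - 1) (by dsimp only; omega)]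
    simp

/-- The contribution of the states with at least `M` jobs in node 1 to the mean return
time vanishes as `M → ∞`. -/
theorem tandem_exists_tail_lt (hne : ∀ x, (tandemSystem lam μ₁ μ₂).outRate x ≠ 0)
    (A : Set (ℕ × ℕ)) {f : ℕ × ℕ → ℝ≥0∞} {x : ℕ × ℕ}
    (hsum : ∑' n, ((tandemSystem lam μ₁ μ₂).stayOp A)^[n] f x ≠ ∞) {η : ℝ≥0∞} (hη : 0 < η) :
    ∃ M, x.1 < M ∧
      ∑' n, ((tandemSystem lam μ₁ μ₂).stayOp A)^[n] ({z | M ≤ z.1}.indicator f) x < η := by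
  have htail := ENNReal.tendsto_sum_nat_add
    (fun n => ((tandemSystem lam μ₁ μ₂).stayOp A)^[n] f x) hsum
  obtain ⟨N, hN⟩ := (htail.eventually_lt_const hη).exists
  have key : ∀ g : ℕ × ℕ → ℝ≥0∞, (∀ z, z.1 < x.1 + N + 1 → g z = 0) → g ≤ f →
      ∑' n, ((tandemSystem lam μ₁ μ₂).stayOp A)^[n] g x < η := by
    intro g hg0 hgf
    have hzero : ∀ k ∈ Finset.range N, ((tandemSystem lam μ₁ μ₂).stayOp A)^[k] g x = 0 := by
      intro k hk
      have := Finset.mem_range.mp hk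
      exact tandem_stayOp_iterate_eq_zero hne A hg0 k x (by omega)
    have hle : ∀ k, ((tandemSystem lam μ₁ μ₂).stayOp A)^[k + N] g x ≤
        ((tandemSystem lam μ₁ μ₂).stayOp A)^[k + N] f x := fun k =>
      TransitionRates.stayOp_iterate_mono _ (k + N) hgf x
    have hsplit := Summable.sum_add_tsum_nat_add' (k := N)
      (f := fun n => ((tandemSystem lam μ₁ μ₂).stayOp A)^[n] g x) ENNReal.summable
    rw [Finset.sum_eq_zero hzero, zero_add] at hsplit
    rw [← hsplit]
    exact lt_of_le_of_lt (ENNReal.tsum_le_tsum hle) hN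
  refine ⟨x.1 + N + 1, by omega, key _ (fun z hz => ?_) (Set.indicator_le_self' fun _ _ => zero_le)⟩
  exact Set.indicator_of_notMem (s := {z : ℕ × ℕ | x.1 + N + 1 ≤ z.1}) (by simpa using hz) f

/-- If `λ` is cut off so that only finitely many values are kept, the solution `d` of the Poisson
equation yields, for every `M`, a function of the form `min x₁ M + h x₂` that is bounded above
and has nonnegative drift off a finite set and off `{x₁ ≥ M}`, where the drift is bounded below
uniformly in `M`. -/
theorem tandem_exists_test_functions (h1 : 0 < μ₁) (h2 : μ₁ < μ₂) {N : ℕ}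
    (hlt : (μ₁ : ℝ) < (1 - (μ₁ : ℝ) / μ₂) * ∑ i ∈ Finset.range N, ((μ₁ : ℝ) / μ₂) ^ i * lam i) :
    ∃ (h : ℕ → ℝ) (H C : ℝ), h 0 = 0 ∧ (∀ j, h j ≤ H) ∧ 0 ≤ C ∧
      ∀ M : ℕ, 0 < M → ∀ x : ℕ × ℕ, -C ≤ tandemGen lam μ₁ μ₂ (fun z => min (z.1 : ℝ) M + h z.2) x ∧
        (x.1 < M → x ∉ ({0} ×ˢ Set.Iic N : Set (ℕ × ℕ)) →
          0 ≤ tandemGen lam μ₁ μ₂ (fun z => min (z.1 : ℝ) M + h z.2) x) := by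
  have r1 : (0 : ℝ) < μ₁ := h1
  have r2 : (μ₁ : ℝ) < μ₂ := h2
  have r3 : (0 : ℝ) < μ₂ := r1.trans r2
  set l : ℕ → ℝ := fun i => if i < N then (lam i : ℝ) else 0 with hl
  have hl0 : ∀ i, 0 ≤ l i := fun i => by simp only [hl]; split_ifs <;> simp
  have hllam : ∀ i, l i ≤ lam i := fun i => by simp only [hl]; split_ifs <;> simp
  have hlN : ∀ i, i ∉ Finset.range N → ((μ₁ : ℝ) / μ₂) ^ i * l i = 0 := fun i hi => by
    simp only [hl]; rw [if_neg (by simpa using hi), mul_zero]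
  have hsum : ∑' i, ((μ₁ : ℝ) / μ₂) ^ i * l i =
      ∑ i ∈ Finset.range N, ((μ₁ : ℝ) / μ₂) ^ i * lam i := by
    rw [tsum_eq_sum hlN]
    refine Finset.sum_congr rfl fun i hi => ?_
    simp only [hl]; rw [if_pos (by simpa using hi)]
  obtain ⟨d, hd0, hdS, -, hdtail⟩ := exists_poisson r1 r2 hl0 (summable_of_ne_finset_zero hlN) rfl
  rw [hsum] at hd0 hdS hdtail
  set c := (1 - (μ₁ : ℝ) / μ₂) * ∑ i ∈ Finset.range N, ((μ₁ : ℝ) / μ₂) ^ i * lam i with hc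
  set a := c * μ₂ / (μ₂ - μ₁) with ha
  have ha0 : 0 < a := div_pos (mul_pos (r1.trans hlt) r3) (by linarith)
  have hdN : ∀ j, N ≤ j + 1 → μ₂ * d j = -a := fun j hj => hdtail j fun i hi => by
    simp only [hl]; rw [if_neg (by omega)]
  set D := ∑ i ∈ Finset.range N, |d i| with hD
  have hD0 : 0 ≤ D := Finset.sum_nonneg fun i _ => abs_nonneg _
  set L := ∑ i ∈ Finset.range N, (lam i : ℝ) with hL
  have hL0 : 0 ≤ L := Finset.sum_nonneg fun i _ => (lam i).coe_nonneg
  have hlL : ∀ i, l i ≤ L := fun i => by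
    simp only [hl]
    split_ifs with hi
    · exact Finset.single_le_sum (f := fun i => (lam i : ℝ)) (fun i _ => (lam i).coe_nonneg)
        (Finset.mem_range.mpr hi)
    · exact hL0
  have hdD : ∀ j, μ₂ * d j ≤ μ₂ * D := fun j => by
    rcases lt_or_ge j N with hj | hj
    · refine mul_le_mul_of_nonneg_left ((le_abs_self _).trans ?_) r3.le
      exact Finset.single_le_sum (f := fun i => |d i|) (fun i _ => abs_nonneg _)
        (Finset.mem_range.mpr hj)
    · rw [hdN j (by omega)]
      have : 0 ≤ μ₂ * D := by positivity
      linarith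
  have hμD : 0 ≤ μ₂ * D := by positivity
  refine ⟨fun j => ∑ i ∈ Finset.range j, d i, D, L + μ₂ * D, by simp, ?_, by positivity, ?_⟩
  · refine sum_range_le_of_eventually_nonpos fun i hi => ?_
    have := hdN i (by omega)
    exact (neg_of_mul_neg_right (by linarith : μ₂ * d i < 0) r3.le).le
  intro M hM
  have hMr : (1 : ℝ) ≤ M := by exact_mod_cast hM
  rintro ⟨x1, x2⟩
  rcases x1 with _ | x1
  · -- node 1 is empty
    have hm0 : min (((0 : ℕ) : ℝ)) (M : ℝ) = 0 := by simp
    have hm1 : min (((0 + 1 : ℕ) : ℝ)) (M : ℝ) = 1 := by simpa using hMr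
    simp only [tandemGen, hm0, hm1]
    rcases x2 with _ | j
    · have := (lam 0).coe_nonneg
      simp only [lt_self_iff_false, if_false]
      constructor
      · linarith
      · intro _ _; linarith
    · have e1 := (lam (j + 1)).coe_nonneg
      have e2 := hdD j
      simp only [lt_self_iff_false, if_false, Nat.succ_pos, if_true, Nat.add_sub_cancel,
        Finset.sum_range_succ]
      constructor
      · linarith
      · intro _ hx
        have := hdN j (by by_contra h; exact hx (by simp; omega))
        linarith
  · -- node 1 is busy: up to the cut-off at `M`, the drift is `λ(j) - l j + c - μ₁`
    have hstep : ∃ p q : ℝ, 0 ≤ p ∧ q ≤ 1 ∧ (x1 + 1 < M → p = 1) ∧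
        min ((x1 + 1 + 1 : ℕ) : ℝ) (M : ℝ) = min ((x1 + 1 : ℕ) : ℝ) (M : ℝ) + p ∧
        min (x1 : ℝ) (M : ℝ) = min ((x1 + 1 : ℕ) : ℝ) (M : ℝ) - q := by
      refine ⟨_, _, ?_, ?_, ?_, (add_sub_cancel _ _).symm, (sub_sub_cancel _ _).symm⟩
      · exact sub_nonneg.mpr (min_le_min_right _ (by push_cast; linarith))
      · push_cast
        rcases le_total (x1 : ℝ) M with h | h
        · rw [min_eq_left h]; linarith [min_le_left ((x1 : ℝ) + 1) M]
        · rw [min_eq_right h]; linarith [min_le_right ((x1 : ℝ) + 1) M]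
      · intro h
        have e1 : ((x1 + 1 + 1 : ℕ) : ℝ) ≤ M := by exact_mod_cast h
        have e2 : ((x1 + 1 : ℕ) : ℝ) ≤ M := by exact_mod_cast h.le
        rw [min_eq_left e1, min_eq_left e2]; push_cast; ring
    obtain ⟨p, q, hp, hq, hp1, hm1, hm2⟩ := hstep
    have hqμ : μ₁ * q ≤ μ₁ := by nlinarith
    simp only [tandemGen, Nat.succ_pos, if_true, Nat.add_sub_cancel, hm1, hm2,
      Finset.sum_range_succ]
    rcases x2 with _ | j
    · have e1 : 0 ≤ lam 0 * p := mul_nonneg (lam 0).coe_nonneg hp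
      have e2 := hlL 0
      have e3 := hllam 0
      simp only [lt_self_iff_false, if_false, Finset.sum_range_zero]
      constructor
      · linarith
      · intro hx _
        rw [hp1 hx]
        linarith
    · have e1 : 0 ≤ lam (j + 1) * p := mul_nonneg (lam (j + 1)).coe_nonneg hp
      have e2 := hlL (j + 1)
      have e3 := hllam (j + 1)
      have e4 := hdS j
      simp only [Nat.succ_pos, if_true, Nat.add_sub_cancel, Finset.sum_range_succ]
      constructor
      · linarith
      · intro hx _
        rw [hp1 hx]
        linarith

theorem tandem_not_isStable (h0 : 0 < lam 0) (h1 : 0 < μ₁) (h2 : μ₁ < μ₂) {N : ℕ}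
    (hlt : (μ₁ : ℝ) < (1 - (μ₁ : ℝ) / μ₂) * ∑ i ∈ Finset.range N, ((μ₁ : ℝ) / μ₂) ^ i * lam i) :
    ¬ IsStableSystem lam μ₁ μ₂ := by
  intro hstable
  obtain ⟨κ, hκ, hq⟩ := tandem_exists_le_outRate h0 h1 (h1.trans h2)
  have hne : ∀ x, (tandemSystem lam μ₁ μ₂).outRate x ≠ 0 := fun x => (hκ.trans_le (hq x)).ne'
  set R := tandemSystem lam μ₁ μ₂ with hR
  set A : Set (ℕ × ℕ) := {(0, 0)}ᶜ with hA
  have hret := (hstable.2 (0, 0)).resolve_left (hne _)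
  -- Finiteness of the mean return time to `(0, 0)` passes to the hitting time from `(m, 0)`.
  have hinit : ∀ m : ℕ, ∑' n, (R.stayOp A)^[n] (fun z => (R.outRate z : ℝ≥0∞)⁻¹) (m, 0) ≠ ∞ ∧
      Filter.Tendsto (fun n => (R.stayOp A)^[n] 1 (m, 0)) Filter.atTop (𝓝 0) := by
    intro m
    induction m with
    | zero => exact ⟨((R.tsum_le_lintegral_hittingTime _).trans_lt hret).ne,
        R.tendsto_stayOp_of_lintegral_hittingTime hret⟩
    | succ m ih =>
      have hz : ((m + 1, 0) : ℕ × ℕ) ∈ A := by simp [hA]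
      have hxz : R.jumpKernel (m, 0) {(m + 1, 0)} ≠ 0 :=
        R.jumpKernel_singleton_ne_zero (hne _) (by simp [hR, tandemSystem, tandemRate, h0.ne'])
      exact ⟨R.tsum_stayOp_ne_top_of_step hz hxz ih.1, R.tendsto_stayOp_of_step hz hxz ih.2⟩
  obtain ⟨h, H, C, hh0, hhH, hC0, hdrift⟩ := tandem_exists_test_functions h1 h2 hlt
  set F : Set (ℕ × ℕ) := {0} ×ˢ Set.Iic N with hF
  obtain ⟨w, K, hwK, hw, hwF⟩ := R.exists_bounded_drift (A := A) (F := F)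
    ((Set.finite_singleton 0).prod (Set.finite_Iic N))
    (fun x _ => R.exists_stayOp_iterate_one_lt_one (tandem_reach h0 h1 (h1.trans h2) x (0, 0)))
    (C.toNNReal / κ)
  obtain ⟨m, hm⟩ := exists_nat_ge ((K : ℝ) + 1)
  -- Beyond the level `M`, the chain started at `(m, 0)` hardly spends any time.
  have hCq : ∀ n, (R.stayOp A)^[n] (fun z => ENNReal.ofReal C * (R.outRate z : ℝ≥0∞)⁻¹) (m, 0) =
      ENNReal.ofReal C * (R.stayOp A)^[n] (fun z => (R.outRate z : ℝ≥0∞)⁻¹) (m, 0) := fun n =>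
    congrFun (R.stayOp_iterate_smul A n (ENNReal.ofReal C) _) (m, 0)
  obtain ⟨M, hmM, hM⟩ := tandem_exists_tail_lt hne A
    (f := fun z => ENNReal.ofReal C * (R.outRate z : ℝ≥0∞)⁻¹) (x := (m, 0)) (by
      simp only [← hR, hCq]
      rw [ENNReal.tsum_mul_left]
      exact ENNReal.mul_ne_top ENNReal.ofReal_ne_top (hinit m).1) one_pos
  dsimp only at hmM
  have hMpos : 0 < M := by omega
  -- The test function is subtracted from its upper bound, to have a nonnegative function whose
  -- drift is at most zero off `F` and `{x₁ ≥ M}`; `w` compensates the drift on `F`.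
  set u : ℕ × ℕ → ℝ := fun z => M + H - (min (z.1 : ℝ) M + h z.2) with hu
  have hu0 : ∀ z, 0 ≤ u z := fun z => by
    have e1 := hhH z.2
    have e2 := min_le_right (z.1 : ℝ) M
    simp only [hu]; linarith
  have hgen : ∀ z, tandemGen lam μ₁ μ₂ u z =
      -tandemGen lam μ₁ μ₂ (fun z => min (z.1 : ℝ) M + h z.2) z := fun z => by
    simp only [tandemGen, hu]; split_ifs <;> ring
  set r : ℕ × ℕ → ℝ≥0∞ := {z : ℕ × ℕ | M ≤ z.1}.indicator
    (fun z => ENNReal.ofReal C * (R.outRate z : ℝ≥0∞)⁻¹) with hr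
  set g : ℕ × ℕ → ℝ≥0∞ := (fun z => ENNReal.ofReal (u z)) + w with hg
  have hgtop : ∀ x, g x ≠ ∞ := fun x => ENNReal.add_ne_top.mpr
    ⟨ENNReal.ofReal_ne_top, ne_top_of_le_ne_top ENNReal.coe_ne_top (hwK x)⟩
  have hCq_le : ∀ x, ∫⁻ z, ENNReal.ofReal (u z) ∂(R.jumpKernel x) ≤
      ENNReal.ofReal (u x) + ENNReal.ofReal C * (R.outRate x : ℝ≥0∞)⁻¹ := fun x => by
    have hpos : (0 : ℝ) < R.outRate x := by exact_mod_cast hκ.trans_le (hq x)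
    rw [tandem_lintegral_ofReal _ _ _ (hne x) hu0, hgen, ← div_eq_mul_inv,
      ← ENNReal.ofReal_coe_nnreal, ← ENNReal.ofReal_div_of_pos hpos,
      ← ENNReal.ofReal_add (hu0 x) (by positivity)]
    refine ENNReal.ofReal_le_ofReal (add_le_add_right ?_ _)
    exact div_le_div_of_nonneg_right (by linarith [(hdrift M hMpos x).1]) hpos.le
  have hmain := R.le_add_tsum_stayOp_iterate (A := A) (g := g) (r := r)
    (s := ENNReal.ofReal (u (0, 0))) ENNReal.ofReal_ne_top
    hgtop
    (fun x => ne_top_of_le_ne_top (ENNReal.mul_ne_top ENNReal.ofReal_ne_top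
      (ENNReal.inv_ne_top.mpr (by simpa using hne x)))
      (Set.indicator_le_self' (fun _ _ => zero_le) x)) ?_ (hinit m).2
  · -- `u (0, 0) = u (m, 0) + m` with `m ≥ K + 1` contradicts the comparison
    have h4 : ENNReal.ofReal (u (0, 0)) < ENNReal.ofReal (u (m, 0)) + K + 1 :=
      lt_of_le_of_lt hmain (ENNReal.add_lt_add_of_le_of_lt
        (hgtop _)
        (add_le_add_right (hwK _) _) hM)
    have hval : u (0, 0) = u (m, 0) + m := by
      have : (m : ℝ) ≤ M := by exact_mod_cast hmM.le
      simp [hu, hh0, this]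
    rw [← ENNReal.ofReal_coe_nnreal, ← ENNReal.ofReal_one,
      ← ENNReal.ofReal_add (hu0 _) K.coe_nonneg,
      ← ENNReal.ofReal_add (add_nonneg (hu0 _) K.coe_nonneg) zero_le_one,
      ENNReal.ofReal_lt_ofReal_iff_of_nonneg (hu0 _), hval] at h4
    linarith
  · intro x
    have key : ∫⁻ z, ENNReal.ofReal (u z) ∂(R.jumpKernel x) + R.stayOp A w x ≤
        ENNReal.ofReal (u x) + w x + r x := by
      by_cases hxF : x ∈ F
      · calc _ ≤ ENNReal.ofReal (u x) + ENNReal.ofReal C * (R.outRate x : ℝ≥0∞)⁻¹ +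
              R.stayOp A w x := add_le_add_left (hCq_le x) _
          _ ≤ ENNReal.ofReal (u x) + (R.stayOp A w x + (C.toNNReal / κ : ℝ≥0)) := by
            rw [add_assoc, add_comm (R.stayOp A w x), ENNReal.coe_div hκ.ne', div_eq_mul_inv]
            gcongr
            · rfl
            · exact hq x
          _ ≤ ENNReal.ofReal (u x) + w x := by gcongr; exact hwF x hxF
          _ ≤ _ := le_self_add
      · by_cases hxM : x.1 < M
        · have hpos : (0 : ℝ) < R.outRate x := by exact_mod_cast hκ.trans_le (hq x)
          refine le_trans (add_le_add ?_ (hw x)) le_self_add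
          rw [tandem_lintegral_ofReal _ _ _ (hne x) hu0, hgen]
          refine ENNReal.ofReal_le_ofReal (add_le_of_nonpos_right ?_)
          exact div_nonpos_of_nonpos_of_nonneg
            (neg_nonpos.mpr ((hdrift M hMpos x).2 hxM hxF)) hpos.le
        · have hrx : r x = ENNReal.ofReal C * (R.outRate x : ℝ≥0∞)⁻¹ :=
            Set.indicator_of_mem (by simpa using hxM) _
          rw [hrx, add_right_comm]
          exact add_le_add (hCq_le x) (hw x)
    have hid := R.stayOp_compl_singleton_add (0, 0) x (fun z => ENNReal.ofReal (u z))
    rw [hg, R.stayOp_add]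
    simp only [Pi.add_apply]
    calc _ = (R.stayOp A (fun z => ENNReal.ofReal (u z)) x + ENNReal.ofReal (u (0, 0))) +
          R.stayOp A w x := by ring
      _ = (∫⁻ z, ENNReal.ofReal (u z) ∂(R.jumpKernel x) + R.stayOp A w x) +
          ENNReal.ofReal (u (0, 0)) * R.stayOp A 1 x := by rw [hid]; ring
      _ ≤ (ENNReal.ofReal (u x) + w x + r x) + ENNReal.ofReal (u (0, 0)) * R.stayOp A 1 x := by
          gcongr
      _ = _ := by ring

end Instability

/-! ### The stability condition -/

theorem lintegral_comp_geom {Ω : Type*} [MeasurableSpace Ω] {P : Measure Ω} {Z : Ω → ℕ} {z : ℝ}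
    (hz0 : 0 ≤ z) (hz1 : z ≤ 1) (hZ : IsGeom P Z z) (f : ℕ → ℝ≥0) :
    ∫⁻ ω, (f (Z ω) : ℝ≥0∞) ∂P = ∑' j, ENNReal.ofReal ((1 - z) * (z ^ j * f j)) := by
  rw [← lintegral_map (f := fun j => (f j : ℝ≥0∞)) (measurable_of_countable _) hZ.1,
    lintegral_countable']
  refine tsum_congr fun j => ?_
  rw [Measure.map_apply hZ.1 (MeasurableSet.singleton j)]
  have : P (Z ⁻¹' {j}) = ENNReal.ofReal ((1 - z) * z ^ j) := hZ.2 j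
  rw [this, ← mul_assoc, ENNReal.ofReal_mul (mul_nonneg (by linarith) (pow_nonneg hz0 j)),
    ENNReal.ofReal_coe_nnreal, mul_comm]

theorem mainTheorem2 (lam : ℕ → ℝ≥0) (μ₁ μ₂ : ℝ≥0) (hμ₁ : 0 < μ₁) (hμ : μ₁ < μ₂)
    (hlam : 0 < lam 0)
    {Ω : Type*} [MeasurableSpace Ω] (P : Measure Ω) [IsProbabilityMeasure P]
    (Z : Ω → ℕ) (hZ : IsGeom P Z ((μ₁ : ℝ) / (μ₂ : ℝ))) :
    (∫⁻ ω, (lam (Z ω) : ℝ≥0∞) ∂P < (μ₁ : ℝ≥0∞) → IsStableSystem lam μ₁ μ₂) ∧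
    ((μ₁ : ℝ≥0∞) < ∫⁻ ω, (lam (Z ω) : ℝ≥0∞) ∂P → ¬ IsStableSystem lam μ₁ μ₂) := by
  have r1 : (0 : ℝ) < μ₁ := hμ₁
  have r2 : (μ₁ : ℝ) < μ₂ := hμ
  have r3 : (0 : ℝ) < μ₂ := r1.trans r2
  have hρ0 : 0 < (μ₁ : ℝ) / μ₂ := div_pos r1 r3
  have hρ1 : (μ₁ : ℝ) / μ₂ < 1 := (div_lt_one r3).mpr r2
  have hnn : ∀ j, 0 ≤ (1 - (μ₁ : ℝ) / μ₂) * (((μ₁ : ℝ) / μ₂) ^ j * lam j) := fun j =>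
    mul_nonneg (by linarith) (by positivity)
  rw [lintegral_comp_geom hρ0.le hρ1.le hZ, ← ENNReal.ofReal_coe_nnreal]
  refine ⟨fun hlt => ?_, fun hlt => ?_⟩
  · have hs : Summable fun j => (1 - (μ₁ : ℝ) / μ₂) * (((μ₁ : ℝ) / μ₂) ^ j * lam j) := by
      refine (ENNReal.summable_toReal hlt.ne_top).congr fun j => ?_
      rw [ENNReal.toReal_ofReal (hnn j)]
    rw [← ENNReal.ofReal_tsum_of_nonneg hnn hs, ENNReal.ofReal_lt_ofReal_iff r1,
      tsum_mul_left] at hlt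
    refine tandem_isStable hlam hμ₁ hμ ?_ hlt
    exact (summable_mul_left_iff (by linarith)).mp hs
  · rw [ENNReal.tsum_eq_iSup_nat, lt_iSup_iff] at hlt
    obtain ⟨N, hN⟩ := hlt
    rw [← ENNReal.ofReal_sum_of_nonneg fun j _ => hnn j,
      ENNReal.ofReal_lt_ofReal_iff_of_nonneg r1.le, ← Finset.mul_sum] at hN
    exact tandem_not_isStable hlam hμ₁ hμ hN
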